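/- \textbf{Setting.} Let $W^\natural,\Delta\in\mathbb{R}^{d\times k}$ with $1\le r^*=\operatorname{rank}(\Delta)<\min\{d,k\}$. Let $\lambda_1^*\ge\dots\ge\lambda_{r^*}^*>0$ be the nonzero singular values of $\Delta$ and $\kappa=\lambda_1^*/\lambda_{r^*}^*$. Let $\tilde x_1,\dots,\tilde x_N\in\mathbb{R}^d$, $d<N$, be i.i.d. centered isotropic random vectors ($\mathbb{E}\,\tilde x_i=0$, $\mathbb{E}\,\tilde x_i\tilde x_i^\top=I_d$) with sub-Gaussian norm $\sup_{\|v\|_2=1}\|\langle v,\tilde x_i\rangle\|_{\psi_2}\le K$, where $\|Z\|_{\psi_2}=\inf\{s>0:\mathbb{E}\exp(Z^2/s^2)\le 2\}$. Let $\tilde X\in\mathbb{R}^{N\times d}$ have rows $\tilde x_i^\top$, and put $\tilde Y=\tilde X(W^\natural+\Delta)$ and $\widehat\Sigma=\frac1N\tilde X^\top\tilde X$. For a rank $r$ with $r^*\le r\le\min\{d,k\}$ consider $$L(W)=\tfrac1{2N}\|\tilde XW-\tilde Y\|_F^2,\qquad \widetilde L(A,B)=\tfrac1{2N}\|\tilde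 X(W^\natural+AB)-\tilde Y\|_F^2,\quad A\in\mathbb{R}^{d\times r},\ B\in\mathbb{R}^{r\times k}.$$ Put $G^\natural=-\nabla L(W^\natural)$. A \emph{spectral initialization} is $A_0=U_{[:,1:r]}\,S^{1/2}_{[1:r]}$, $B_0=S^{1/2}_{[1:r]}\,V_{[:,1:r]}^\top$ for a complete singular value decomposition $G^\natural=USV^\top$ with singular values in nonincreasing order, where $S^{1/2}_{[1:r]}$ is the leading $r\times r$ block of the entrywise square root of $S$. Gradient descent with step size $\eta>0$ is $$A_{t+1}=A_t-\eta\nabla_A\widetilde L(A_t,B_t),\qquad B_{t+1}=B_t-\eta\nabla_B\widetilde L(A_t,B_t).$$ \textbf{Theorem.} For every $K$ there are constants $C,c>0$ depending only on $K$ such that, in the setting above, for all $\epsilon>0$ and $\eta>0$ with $$\epsilon\le\min\Big\{\frac1{2\kappa},\ \frac{\lambda_{r^*}^*}{32\kappa(32\lambda_1^*+128\kappa^2)}\Big\},\qquad \eta\le\min\Big\{\frac1{128\kappa\lambda_1^*},\ \frac{1-\epsilon/\kappa}{1152\lambda_1^*}\Big\},$$ the following holds with probability at least $1-2C^d\exp(-c\,\epsilon^2N)$: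 $\|\widehat\Sigma-I_d\|_{op}\le\epsilon$, and, for every spectral initialization $(A_0,B_0)$, $$\|A_tB_t-\Delta\|_F\le\sqrt{2r^*}\Big(1-\eta\frac{\lambda_{r^*}^*}{64\kappa}\Big)^t\lambda_{r^*}^*\qquad\text{for all } t\ge0.$$ -/

import Mathlib

open MeasureTheory ProbabilityTheory
open scoped Matrix ENNReal NNReal

noncomputable section

namespace LoRA

/-! ### Matrices -/

/-- Frobenius norm. -/
def frobNorm {m n : ℕ} (M : Matrix (Fin m) (Fin n) ℝ) : ℝ :=
  Real.sqrt (∑ i, ∑ j, M i j ^ 2)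

/-- Operator norm of a square matrix with respect to the Euclidean norm. -/
def opNorm {n : ℕ} (M : Matrix (Fin n) (Fin n) ℝ) : ℝ :=
  ‖Matrix.toEuclideanCLM (n := Fin n) (𝕜 := ℝ) M‖

/-- The `i`-th largest singular value of `M`, counted from `i = 1` and with multiplicity.
(Mathlib's `LinearMap.singularValues` counts from `0`.) -/
def sval {m n : ℕ} (M : Matrix (Fin m) (Fin n) ℝ) (i : ℕ) : ℝ :=
  (Matrix.toEuclideanLin M).singularValues (i - 1)

/-- The condition number of a nonzero matrix: its largest singular value divided by its
smallest nonzero singular value, which is the one with index `rank M`. -/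
def condNumber {m n : ℕ} (M : Matrix (Fin m) (Fin n) ℝ) : ℝ :=
  sval M 1 / sval M M.rank

/-- The gradient matrix of a real function of a matrix: the matrix of its partial derivatives
in the entries. -/
def matGrad {m n : ℕ} (f : Matrix (Fin m) (Fin n) ℝ → ℝ) (M : Matrix (Fin m) (Fin n) ℝ) :
    Matrix (Fin m) (Fin n) ℝ :=
  Matrix.of fun i j => deriv (fun s : ℝ => f (M + s • Matrix.single i j (1 : ℝ))) 0

/-- `G = U S Vᵀ` is a complete singular value decomposition: `U` and `V` are orthogonal, and `S` is
rectangular diagonal with nonnegative, nonincreasing diagonal entries. -/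
structure IsSVD {d k : ℕ} (G : Matrix (Fin d) (Fin k) ℝ) (U : Matrix (Fin d) (Fin d) ℝ)
    (S : Matrix (Fin d) (Fin k) ℝ) (V : Matrix (Fin k) (Fin k) ℝ) : Prop where
  left_orthogonal : U ∈ Matrix.orthogonalGroup (Fin d) ℝ
  right_orthogonal : V ∈ Matrix.orthogonalGroup (Fin k) ℝ
  diagonal : ∀ (i : Fin d) (j : Fin k), (i : ℕ) ≠ (j : ℕ) → S i j = 0
  nonneg : ∀ (i : Fin d) (j : Fin k), 0 ≤ S i j
  sorted : ∀ (i i' : Fin d) (j j' : Fin k), (i : ℕ) = (j : ℕ) → (i' : ℕ) = (j' : ℕ) →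
    i ≤ i' → S i' j' ≤ S i j
  eq_mul : G = U * S * Vᵀ

/-- Spectral initialization of rank `r` from `G`: for some complete singular value decomposition
`G = U S Vᵀ`, `A₀ = U[:, 1:r] S^{1/2}[1:r]` and `B₀ = S^{1/2}[1:r] (V[:, 1:r])ᵀ`, where `[1:r]` is
the leading `r × r` block. (The entries of `S` off the diagonal vanish, so that the entrywise
square root of `S` is `S^{1/2}`.) -/
def IsSpectralInit {d k r : ℕ} (hrd : r ≤ d) (hrk : r ≤ k) (G : Matrix (Fin d) (Fin k) ℝ)
    (A₀ : Matrix (Fin d) (Fin r) ℝ) (B₀ : Matrix (Fin r) (Fin k) ℝ) : Prop :=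
  ∃ (U : Matrix (Fin d) (Fin d) ℝ) (S : Matrix (Fin d) (Fin k) ℝ)
    (V : Matrix (Fin k) (Fin k) ℝ), IsSVD G U S V ∧
    A₀ = U.submatrix id (Fin.castLE hrd) *
      (S.map Real.sqrt).submatrix (Fin.castLE hrd) (Fin.castLE hrk) ∧
    B₀ = (S.map Real.sqrt).submatrix (Fin.castLE hrd) (Fin.castLE hrk) *
      (V.submatrix id (Fin.castLE hrk))ᵀ

/-! ### Fine-tuning the linear model -/

/-- Loss of full fine-tuning: `L(W) = ‖X W - Y‖_F² / (2N)`. -/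
def fullLoss {N d k : ℕ} (X : Matrix (Fin N) (Fin d) ℝ) (Y : Matrix (Fin N) (Fin k) ℝ)
    (W : Matrix (Fin d) (Fin k) ℝ) : ℝ :=
  1 / (2 * (N : ℝ)) * frobNorm (X * W - Y) ^ 2

/-- LoRA loss: `L̃(A, B) = ‖X (W₀ + A B) - Y‖_F² / (2N)`, with pre-trained weights `W₀`. -/
def loraLoss {N d k r : ℕ} (X : Matrix (Fin N) (Fin d) ℝ) (Y : Matrix (Fin N) (Fin k) ℝ)
    (W₀ : Matrix (Fin d) (Fin k) ℝ) (A : Matrix (Fin d) (Fin r) ℝ)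
    (B : Matrix (Fin r) (Fin k) ℝ) : ℝ :=
  1 / (2 * (N : ℝ)) * frobNorm (X * (W₀ + A * B) - Y) ^ 2

/-- The negative gradient of full fine-tuning at the pre-trained weights `W₀`. -/
def oneStepGrad {N d k : ℕ} (X : Matrix (Fin N) (Fin d) ℝ) (Y : Matrix (Fin N) (Fin k) ℝ)
    (W₀ : Matrix (Fin d) (Fin k) ℝ) : Matrix (Fin d) (Fin k) ℝ :=
  -matGrad (fullLoss X Y) W₀

/-- The iterates `(A_t, B_t)` of gradient descent with step size `η` on the LoRA loss, both factors
being updated simultaneously, started at `(A₀, B₀)`. -/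
def gdIter {N d k r : ℕ} (X : Matrix (Fin N) (Fin d) ℝ) (Y : Matrix (Fin N) (Fin k) ℝ)
    (W₀ : Matrix (Fin d) (Fin k) ℝ) (η : ℝ) (A₀ : Matrix (Fin d) (Fin r) ℝ)
    (B₀ : Matrix (Fin r) (Fin k) ℝ) :
    ℕ → Matrix (Fin d) (Fin r) ℝ × Matrix (Fin r) (Fin k) ℝ
  | 0 => (A₀, B₀)
  | t + 1 =>
    let A := (gdIter X Y W₀ η A₀ B₀ t).1
    let B := (gdIter X Y W₀ η A₀ B₀ t).2
    (A - η • matGrad (fun A' => loraLoss X Y W₀ A' B) A,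
      B - η • matGrad (fun B' => loraLoss X Y W₀ A B') B)

/-! ### Sub-Gaussian data -/

variable {Ω : Type*} [MeasurableSpace Ω]

/-- The sub-Gaussian norm `‖Z‖_{ψ₂} = inf {s > 0 | E exp(Z² / s²) ≤ 2}` of a real random variable,
equal to `∞` when there is no such `s`. -/
def psi2Norm (μ : Measure Ω) (Z : Ω → ℝ) : ℝ≥0∞ :=
  ⨅ (s : ℝ) (_ : 0 < s ∧ ∫⁻ ω, ENNReal.ofReal (Real.exp (Z ω ^ 2 / s ^ 2)) ∂μ ≤ 2),
    ENNReal.ofReal s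

/-- The sub-Gaussian norm of a random vector: the supremum of the sub-Gaussian norms of its
one-dimensional marginals `⟨v, x⟩`, `‖v‖ = 1`. -/
def psi2NormVec {d : ℕ} (μ : Measure Ω) (x : Ω → EuclideanSpace ℝ (Fin d)) : ℝ≥0∞ :=
  ⨆ (v : EuclideanSpace ℝ (Fin d)) (_ : ‖v‖ = 1), psi2Norm μ fun ω => inner ℝ v (x ω)

/-- A centered, isotropic (identity covariance) random vector with sub-Gaussian norm at most `K`. -/
structure IsIsotropicSubGaussian {d : ℕ} (μ : Measure Ω) (x : Ω → EuclideanSpace ℝ (Fin d))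
    (K : ℝ≥0) : Prop where
  measurable : Measurable x
  centered : ∀ a, ∫ ω, x ω a ∂μ = 0
  isotropic : ∀ a b, ∫ ω, x ω a * x ω b ∂μ = if a = b then 1 else 0
  subGaussian : psi2NormVec μ x ≤ (K : ℝ≥0∞)

/-- The data matrix with rows `x₁, …, x_N`. -/
def dataMatrix {N d : ℕ} (x : Fin N → Ω → EuclideanSpace ℝ (Fin d)) (ω : Ω) :
    Matrix (Fin N) (Fin d) ℝ :=
  Matrix.of fun i j => x i ω j

/-- The empirical covariance matrix `Xᵀ X / N`. -/
def empCov {N d : ℕ} (X : Matrix (Fin N) (Fin d) ℝ) : Matrix (Fin d) (Fin d) ℝ :=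
  (1 / (N : ℝ)) • (Xᵀ * X)

end LoRA

end

/-! The data enter only through the empirical covariance `Σ = empCov X`. Since `Y` is noiseless, the
one-step gradient is `G = ΣΔ`, and the two gradients of the LoRA loss are `ΣEBᵀ` and `AᵀΣE` with
residual `E = AB - Δ`. So the theorem splits into a probabilistic part, `‖Σ - 1‖ ≤ ε`, and a
deterministic part valid on that event.

Deterministic part. As `rank G ≤ rank Δ ≤ r`, a spectral initialization satisfies `A₀B₀ = G`, so the
initial residual `(Σ - 1)Δ` has operator norm at most `ελ₁`. Up to terms of order `ηε` and `η²`, one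
step maps `E` to `(1 - ηAAᵀ) E (1 - ηBᵀB)`. The left factor is merely nonexpansive. The right factor
contracts, because the rows of `E` stay in the row space of `Δ`, where `B` is coercive: `B₀ᵀB₀` is
the square root of `GᵀG`, whose nonzero eigenvalues are at least `(1 - ε)λ_{r*}`. Coercivity on one
side is enough, so directions left over when `r > r*` do no harm. The residuals decay geometrically,
hence the total displacement of `A` and `B` is a small multiple of `√λ_{r*}` and the bounds on the
factors persist (`norm_gd_residual_le`, `gd_converges`). The operator norm is turned into the
Frobenius norm at the cost of `√r*`, since `E` lives on a row space of dimension at most `r*`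
(`IsSVD.frobNorm_le`).

Probabilistic part. For a fixed unit vector, Bernstein's inequality controls the empirical second
moment of the marginal; a union bound over a `1/2`-net of at most `5^d` points of the sphere
controls the symmetric matrix `Σ - 1` (`measure_abs_sum_sq_sub_one_ge_le`, `exists_sphere_net`,
`norm_le_of_net`). -/

namespace LoRA

/-! ### Operator norm estimates and the contraction of one gradient step -/

section OperatorNorm

open scoped Matrix.Norms.L2Operator

variable {m n p : ℕ}

/-- The matrix-vector product on Euclidean spaces. -/
noncomputable def act (M : Matrix (Fin m) (Fin n) ℝ) (v : EuclideanSpace ℝ (Fin n)) :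
    EuclideanSpace ℝ (Fin m) :=
  WithLp.toLp 2 (M *ᵥ v.ofLp)

theorem norm_act_le (M : Matrix (Fin m) (Fin n) ℝ) (v : EuclideanSpace ℝ (Fin n)) :
    ‖act M v‖ ≤ ‖M‖ * ‖v‖ :=
  M.l2_opNorm_mulVec v

theorem act_mul (M : Matrix (Fin m) (Fin n) ℝ) (M' : Matrix (Fin n) (Fin p) ℝ)
    (v : EuclideanSpace ℝ (Fin p)) : act (M * M') v = act M (act M' v) := by
  simp [act, Matrix.mulVec_mulVec]

theorem act_sub (M M' : Matrix (Fin m) (Fin n) ℝ) (v : EuclideanSpace ℝ (Fin n)) :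
    act (M - M') v = act M v - act M' v := by
  simp [act, Matrix.sub_mulVec]

theorem act_smul (c : ℝ) (M : Matrix (Fin m) (Fin n) ℝ) (v : EuclideanSpace ℝ (Fin n)) :
    act (c • M) v = c • act M v := by
  simp [act, Matrix.smul_mulVec]

theorem act_one (v : EuclideanSpace ℝ (Fin n)) : act 1 v = v := by
  simp [act]

theorem opNorm_le_of_act (M : Matrix (Fin m) (Fin n) ℝ) {c : ℝ} (hc : 0 ≤ c)
    (h : ∀ v, ‖act M v‖ ≤ c * ‖v‖) : ‖M‖ ≤ c := by
  rw [Matrix.l2_opNorm_def]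
  exact ContinuousLinearMap.opNorm_le_bound _ hc h

theorem inner_act (M : Matrix (Fin m) (Fin n) ℝ) (v : EuclideanSpace ℝ (Fin n))
    (w : EuclideanSpace ℝ (Fin m)) : inner ℝ (act M v) w = inner ℝ v (act Mᵀ w) := by
  simp only [act, EuclideanSpace.inner_eq_star_dotProduct, star_trivial]
  rw [Matrix.mulVec_transpose, ← Matrix.dotProduct_mulVec]

theorem norm_transpose (M : Matrix (Fin m) (Fin n) ℝ) : ‖Mᵀ‖ = ‖M‖ := by
  rw [← Matrix.l2_opNorm_conjTranspose M, Matrix.conjTranspose_eq_transpose_of_trivial]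

theorem norm_transpose_mul_self (M : Matrix (Fin m) (Fin n) ℝ) : ‖Mᵀ * M‖ = ‖M‖ * ‖M‖ := by
  rw [← Matrix.l2_opNorm_conjTranspose_mul_self M, Matrix.conjTranspose_eq_transpose_of_trivial]

theorem opNorm_eq_norm (M : Matrix (Fin n) (Fin n) ℝ) : opNorm M = ‖M‖ := rfl

/-- A gradient step on `w ↦ ‖M w‖² / 2` contracts. -/
theorem norm_act_one_sub_sq_le (M : Matrix (Fin m) (Fin n) ℝ) {η β : ℝ} (hη : 0 ≤ η)
    (hM : η * ‖M‖ ^ 2 ≤ 1) (w : EuclideanSpace ℝ (Fin n)) (hβ : 0 ≤ β)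
    (hw : β * ‖w‖ ≤ ‖act M w‖) :
    ‖act (1 - η • (Mᵀ * M)) w‖ ^ 2 ≤ (1 - η * β ^ 2) * ‖w‖ ^ 2 := by
  rw [act_sub, act_one, act_smul, act_mul, norm_sub_sq_real, inner_smul_right, ← inner_act,
    real_inner_self_eq_norm_sq, norm_smul, Real.norm_of_nonneg hη]
  have h1 : ‖act Mᵀ (act M w)‖ ≤ ‖M‖ * ‖act M w‖ := by
    simpa [norm_transpose] using norm_act_le Mᵀ (act M w)
  have h2 : (η * ‖act Mᵀ (act M w)‖) ^ 2 ≤ η * ‖act M w‖ ^ 2 := by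
    calc (η * ‖act Mᵀ (act M w)‖) ^ 2 ≤ (η * (‖M‖ * ‖act M w‖)) ^ 2 := by gcongr
      _ = (η * ‖M‖ ^ 2) * (η * ‖act M w‖ ^ 2) := by ring
      _ ≤ 1 * (η * ‖act M w‖ ^ 2) := by gcongr
      _ = _ := one_mul _
  have h3 : (β * ‖w‖) ^ 2 ≤ ‖act M w‖ ^ 2 := by gcongr
  nlinarith [mul_le_mul_of_nonneg_left h3 hη]

theorem norm_act_one_sub_le (M : Matrix (Fin m) (Fin n) ℝ) {η β : ℝ} (hη : 0 ≤ η)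
    (hM : η * ‖M‖ ^ 2 ≤ 1) (w : EuclideanSpace ℝ (Fin n)) (hβ : 0 ≤ β)
    (hw : β * ‖w‖ ≤ ‖act M w‖) (hηβ : η * β ^ 2 ≤ 1) :
    ‖act (1 - η • (Mᵀ * M)) w‖ ≤ (1 - η * β ^ 2 / 2) * ‖w‖ := by
  have h := norm_act_one_sub_sq_le M hη hM w hβ hw
  have h0 : 0 ≤ 1 - η * β ^ 2 / 2 := by nlinarith
  refine le_of_sq_le_sq (h.trans ?_) (by positivity)
  -- With `x = ηβ²`, this is `1 - x ≤ (1 - x/2)²`.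
  nlinarith [mul_nonneg (sq_nonneg (η * β ^ 2)) (sq_nonneg ‖w‖)]

/-- The case `β = 0` of the contraction: without coercivity the step is still nonexpansive. This is
all that is asked of the left factor `1 - ηAAᵀ`. -/
theorem norm_one_sub_le (M : Matrix (Fin m) (Fin n) ℝ) {η : ℝ} (hη : 0 ≤ η)
    (hM : η * ‖M‖ ^ 2 ≤ 1) : ‖1 - η • (Mᵀ * M)‖ ≤ 1 := by
  refine opNorm_le_of_act _ zero_le_one fun v => ?_
  simpa using norm_act_one_sub_le M hη hM v le_rfl (by simp) (by simp)

/-- Contraction on the right by a gradient step which is coercive on the rows. -/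
theorem norm_mul_one_sub_le (E : Matrix (Fin p) (Fin n) ℝ) (M : Matrix (Fin m) (Fin n) ℝ)
    (P : Matrix (Fin n) (Fin n) ℝ) (hP : Pᵀ = P) (hEP : E * P = E) {η β : ℝ} (hη : 0 ≤ η)
    (hM : η * ‖M‖ ^ 2 ≤ 1) (hβ : 0 ≤ β) (hw : ∀ w, act P w = w → β * ‖w‖ ≤ ‖act M w‖)
    (hηβ : η * β ^ 2 ≤ 1) :
    ‖E * (1 - η • (Mᵀ * M))‖ ≤ (1 - η * β ^ 2 / 2) * ‖E‖ := by
  have h0 : 0 ≤ 1 - η * β ^ 2 / 2 := by nlinarith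
  have ht : (E * (1 - η • (Mᵀ * M)))ᵀ = (1 - η • (Mᵀ * M)) * Eᵀ := by
    simp [Matrix.transpose_mul, Matrix.transpose_sub]
  rw [← norm_transpose, ht]
  refine opNorm_le_of_act _ (by positivity) fun v => ?_
  rw [act_mul]
  have hPE : act P (act Eᵀ v) = act Eᵀ v := by
    rw [← act_mul]
    conv_rhs => rw [← hEP, Matrix.transpose_mul, hP]
  refine (norm_act_one_sub_le M hη hM _ hβ (hw _ hPE) hηβ).trans ?_
  rw [mul_assoc]
  gcongr
  simpa [norm_transpose] using norm_act_le Eᵀ v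

theorem norm_mul_le' {q : ℕ} {X : Matrix (Fin m) (Fin n) ℝ} {Y : Matrix (Fin n) (Fin q) ℝ}
    {x y : ℝ} (hX : ‖X‖ ≤ x) (hY : ‖Y‖ ≤ y) : ‖X * Y‖ ≤ x * y :=
  (Matrix.l2_opNorm_mul X Y).trans
    (mul_le_mul hX hY (norm_nonneg _) ((norm_nonneg _).trans hX))

theorem norm_one_matrix_le : ‖(1 : Matrix (Fin n) (Fin n) ℝ)‖ ≤ 1 :=
  opNorm_le_of_act _ zero_le_one fun v => by simp [act_one]

theorem norm_le_one_add {Sig : Matrix (Fin n) (Fin n) ℝ} {ε : ℝ} (h : ‖Sig - 1‖ ≤ ε) :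
    ‖Sig‖ ≤ 1 + ε := by
  calc ‖Sig‖ = ‖1 + (Sig - 1)‖ := by simp
    _ ≤ 1 + ε := (norm_add_le _ _).trans (add_le_add norm_one_matrix_le h)

variable {d k r : ℕ}

/-- Replacing `Σ` by `1 + (Σ - 1)` isolates the first-order errors. The term `η² AAᵀEBᵀB` is added
to complete the two-sided product and is subtracted again in the last summand. -/
theorem gd_residual_eq (Sig : Matrix (Fin d) (Fin d) ℝ) (Δ E : Matrix (Fin d) (Fin k) ℝ)
    (A : Matrix (Fin d) (Fin r) ℝ) (B : Matrix (Fin r) (Fin k) ℝ) (hE : A * B - Δ = E) (η : ℝ) :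
    (A - η • (Sig * E * Bᵀ)) * (B - η • (Aᵀ * (Sig * E))) - Δ =
      (1 - η • (Aᵀᵀ * Aᵀ)) * (E * (1 - η • (Bᵀ * B))) - η • ((Sig - 1) * (E * (Bᵀ * B)))
        - η • ((A * Aᵀ) * ((Sig - 1) * E))
        + η ^ 2 • (Sig * E * (Bᵀ * Aᵀ) * (Sig * E) - (A * Aᵀ) * (E * (Bᵀ * B))) := by
  subst hE
  simp only [Matrix.transpose_transpose, Matrix.mul_sub, Matrix.sub_mul, Matrix.mul_smul,
    Matrix.smul_mul, Matrix.mul_assoc, Matrix.one_mul, Matrix.mul_one]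
  module

/-- One step of gradient descent contracts the residual. -/
theorem norm_gd_residual_le {Sig : Matrix (Fin d) (Fin d) ℝ} {Δ E : Matrix (Fin d) (Fin k) ℝ}
    {A : Matrix (Fin d) (Fin r) ℝ} {B : Matrix (Fin r) (Fin k) ℝ} (hE : A * B - Δ = E)
    {P : Matrix (Fin k) (Fin k) ℝ} (hP : Pᵀ = P) (hEP : E * P = E) {ε η α β : ℝ}
    (hSig : ‖Sig - 1‖ ≤ ε) (hη : 0 ≤ η) (hA : ‖A‖ ≤ α) (hB : ‖B‖ ≤ α) (hβ : 0 ≤ β)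
    (hw : ∀ w, act P w = w → β * ‖w‖ ≤ ‖act B w‖) (hηα : η * α ^ 2 ≤ 1) (hηβ : η * β ^ 2 ≤ 1) :
    ‖(A - η • (Sig * E * Bᵀ)) * (B - η • (Aᵀ * (Sig * E))) - Δ‖ ≤
      (1 - η * β ^ 2 / 2 + 2 * η * ε * α ^ 2
        + η ^ 2 * ((1 + ε) ^ 2 * ‖E‖ * α ^ 2 + α ^ 4)) * ‖E‖ := by
  have hAt : ‖Aᵀ‖ ≤ α := by rwa [norm_transpose]
  have hBt : ‖Bᵀ‖ ≤ α := by rwa [norm_transpose]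
  have hSE : ‖Sig * E‖ ≤ (1 + ε) * ‖E‖ := norm_mul_le' (norm_le_one_add hSig) le_rfl
  have h1 : ‖(1 - η • (Aᵀᵀ * Aᵀ)) * (E * (1 - η • (Bᵀ * B)))‖
      ≤ 1 * ((1 - η * β ^ 2 / 2) * ‖E‖) := by
    refine norm_mul_le' (norm_one_sub_le _ hη (le_trans ?_ hηα))
      (norm_mul_one_sub_le E B P hP hEP hη (le_trans ?_ hηα) hβ hw hηβ) <;> gcongr
  have h2 : ‖(Sig - 1) * (E * (Bᵀ * B))‖ ≤ ε * (‖E‖ * (α * α)) :=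
    norm_mul_le' hSig (norm_mul_le' le_rfl (norm_mul_le' hBt hB))
  have h3 : ‖(A * Aᵀ) * ((Sig - 1) * E)‖ ≤ (α * α) * (ε * ‖E‖) :=
    norm_mul_le' (norm_mul_le' hA hAt) (norm_mul_le' hSig le_rfl)
  have h4 : ‖Sig * E * (Bᵀ * Aᵀ) * (Sig * E)‖ ≤ (1 + ε) * ‖E‖ * (α * α) * ((1 + ε) * ‖E‖) :=
    norm_mul_le' (norm_mul_le' hSE (norm_mul_le' hBt hAt)) hSE
  have h5 : ‖(A * Aᵀ) * (E * (Bᵀ * B))‖ ≤ (α * α) * (‖E‖ * (α * α)) :=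
    norm_mul_le' (norm_mul_le' hA hAt) (norm_mul_le' le_rfl (norm_mul_le' hBt hB))
  rw [gd_residual_eq Sig Δ E A B hE]
  refine (norm_add_le _ _).trans ((add_le_add ((norm_sub_le _ _).trans
    (add_le_add (norm_sub_le _ _) le_rfl)) le_rfl).trans ?_)
  rw [norm_smul, norm_smul, norm_smul, Real.norm_of_nonneg hη,
    Real.norm_of_nonneg (sq_nonneg η)]
  have h6 := (norm_sub_le (Sig * E * (Bᵀ * Aᵀ) * (Sig * E)) ((A * Aᵀ) * (E * (Bᵀ * B)))).trans
    (add_le_add h4 h5)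
  have h2' := mul_le_mul_of_nonneg_left h2 hη
  have h3' := mul_le_mul_of_nonneg_left h3 hη
  have h6' := mul_le_mul_of_nonneg_left h6 (sq_nonneg η)
  linarith

/-! ### Scalar conditions and linear convergence in operator norm -/

/-- The conditions on the accuracy `ε`, the step size `η`, the largest singular value `L`, the
smallest nonzero singular value `l` and their quotient `κ` under which the residual contracts. -/
structure StepConditions (L l κ ε η : ℝ) : Prop where
  l_pos : 0 < l
  one_le : 1 ≤ κ
  eq_mul : L = κ * l
  ε_pos : 0 < ε
  ε_le : 1024 * κ ^ 2 * ε ≤ 1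
  η_pos : 0 < η
  η_le : 128 * κ * L * η ≤ 1
  η_le' : 1152 * L * η ≤ 1

namespace StepConditions

variable {L l κ ε η : ℝ}

theorem ε_le_inv (h : StepConditions L l κ ε η) : 1024 * ε ≤ 1 := by
  have := h.one_le
  nlinarith [h.ε_le, mul_nonneg h.ε_pos.le (by nlinarith : 0 ≤ κ ^ 2 - 1)]

theorem εκ_le (h : StepConditions L l κ ε η) : 1024 * (ε * κ) ≤ 1 := by
  have := h.one_le
  nlinarith [h.ε_le, mul_nonneg h.ε_pos.le (by nlinarith : 0 ≤ κ ^ 2 - κ)]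

theorem l_le (h : StepConditions L l κ ε η) : l ≤ L := by
  nlinarith [h.one_le, h.eq_mul, h.l_pos]

theorem L_pos (h : StepConditions L l κ ε η) : 0 < L := h.l_pos.trans_le h.l_le

theorem εL_le (h : StepConditions L l κ ε η) : 1024 * (ε * L) ≤ l := by
  have := mul_le_mul_of_nonneg_right h.εκ_le h.l_pos.le
  rw [h.eq_mul]; linarith

/-- The step-size condition multiplied by `l`, with `κ * l = L`; it makes the second-order terms of
a step small compared with the gain `η * l`. -/
theorem ηLL_le (h : StepConditions L l κ ε η) : 128 * (η * L ^ 2) ≤ l := by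
  have := mul_le_mul_of_nonneg_right h.η_le h.l_pos.le
  have e : 128 * (η * L ^ 2) = 128 * κ * L * η * l := by rw [h.eq_mul]; ring
  linarith

theorem ηl_le (h : StepConditions L l κ ε η) : 1152 * (η * l) ≤ 1 := by
  have := mul_le_mul_of_nonneg_left h.l_le h.η_pos.le
  linarith [h.η_le']

theorem rate_nonneg (h : StepConditions L l κ ε η) : 0 ≤ 1 - η * l / 4 := by
  linarith [h.ηl_le]

/-- The gain is at least `0.49 ηl`. The covariance error costs at most `2.06 ηl / 1024` and the
second-order terms at most `2η²L² ≤ ηl / 64`, which leaves more than `ηl / 4`. -/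
theorem factor_le (h : StepConditions L l κ ε η) {α β e : ℝ} (hα : α ^ 2 ≤ 1.03 * L)
    (hβ : 0.98 * l ≤ β ^ 2) (he0 : 0 ≤ e) (he : e ≤ ε * L) :
    1 - η * β ^ 2 / 2 + 2 * η * ε * α ^ 2 + η ^ 2 * ((1 + ε) ^ 2 * e * α ^ 2 + α ^ 4)
      ≤ 1 - η * l / 4 := by
  have hη := h.η_pos
  have hL := h.L_pos
  have hε := h.ε_pos
  have hl := h.l_pos
  have h1 : η * (0.98 * l) ≤ η * β ^ 2 := by gcongr
  have h2 : 2 * η * ε * α ^ 2 ≤ 2 * η * ε * (1.03 * L) := by gcongr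
  have h2' : η * (1024 * (ε * L)) ≤ η * l := by gcongr; exact h.εL_le
  have h3 : e ≤ 0.001 * L := by nlinarith [h.ε_le_inv]
  have h4 : (1 + ε) ^ 2 ≤ 1.1 := by nlinarith [h.ε_le_inv]
  have h5 : (1 + ε) ^ 2 * e * α ^ 2 + α ^ 4 ≤ 1.1 * (0.001 * L) * (1.03 * L) + (1.03 * L) ^ 2 := by
    have : α ^ 4 = (α ^ 2) ^ 2 := by ring
    rw [this]
    gcongr
  have h6 : η ^ 2 * ((1 + ε) ^ 2 * e * α ^ 2 + α ^ 4) ≤ η ^ 2 * (2 * L ^ 2) := by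
    gcongr
    nlinarith [sq_nonneg L]
  have h7 : η * (128 * (η * L ^ 2)) ≤ η * l := by gcongr; exact h.ηLL_le
  nlinarith [mul_pos hη hl]

end StepConditions

theorem norm_le_of_sub {M M₀ : Matrix (Fin m) (Fin n) ℝ} {x y : ℝ} (h₀ : ‖M₀‖ ≤ x)
    (h : ‖M - M₀‖ ≤ y) : ‖M‖ ≤ x + y := by
  calc ‖M‖ = ‖M₀ + (M - M₀)‖ := by simp
    _ ≤ x + y := (norm_add_le _ _).trans (add_le_add h₀ h)

theorem norm_act_ge_of_sub {M M₀ : Matrix (Fin m) (Fin n) ℝ} {w : EuclideanSpace ℝ (Fin n)}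
    {x y : ℝ} (h₀ : x * ‖w‖ ≤ ‖act M₀ w‖) (h : ‖M - M₀‖ ≤ y) : (x - y) * ‖w‖ ≤ ‖act M w‖ := by
  have h1 : ‖act M₀ w‖ ≤ ‖act M w‖ + ‖act (M - M₀) w‖ := by
    rw [act_sub]
    have := norm_sub_le (act M w) (act M w - act M₀ w)
    simpa using this
  have h2 : ‖act (M - M₀) w‖ ≤ y * ‖w‖ := (norm_act_le _ _).trans (by gcongr)
  linarith

/-- Gradient descent from a balanced, nearly exact initialization converges linearly in the
operator norm. -/
theorem gd_converges {L l κ ε η : ℝ} (h : StepConditions L l κ ε η)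
    {Sig : Matrix (Fin d) (Fin d) ℝ} {Δ : Matrix (Fin d) (Fin k) ℝ}
    {P : Matrix (Fin k) (Fin k) ℝ} {A : ℕ → Matrix (Fin d) (Fin r) ℝ}
    {B : ℕ → Matrix (Fin r) (Fin k) ℝ} (hP : Pᵀ = P) (hΔP : Δ * P = Δ) (hSig : ‖Sig - 1‖ ≤ ε)
    (hA : ∀ t, A (t + 1) = A t - η • (Sig * (A t * B t - Δ) * (B t)ᵀ))
    (hB : ∀ t, B (t + 1) = B t - η • ((A t)ᵀ * (Sig * (A t * B t - Δ))))
    (hBP : B 0 * P = B 0) (hA0 : ‖A 0‖ ^ 2 ≤ (1 + ε) * L) (hB0 : ‖B 0‖ ^ 2 ≤ (1 + ε) * L)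
    (hw : ∀ w, act P w = w → (1 - ε) * l * ‖w‖ ^ 2 ≤ ‖act (B 0) w‖ ^ 2)
    (hE0 : ‖A 0 * B 0 - Δ‖ ≤ ε * L) (t : ℕ) :
    B t * P = B t ∧ ‖A t * B t - Δ‖ ≤ (1 - η * l / 4) ^ t * (ε * L) ∧
      ‖A t - A 0‖ ≤ √l / 200 * (1 - (1 - η * l / 4) ^ t) ∧
      ‖B t - B 0‖ ≤ √l / 200 * (1 - (1 - η * l / 4) ^ t) := by
  have hη := h.η_pos
  have hL := h.L_pos
  have hε := h.ε_pos
  have hl := h.l_pos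
  have ha2 : √L ^ 2 = L := Real.sq_sqrt hL.le
  have hb2 : √l ^ 2 = l := Real.sq_sqrt hl.le
  have ha : 0 < √L := Real.sqrt_pos.2 hL
  have hb : 0 < √l := Real.sqrt_pos.2 hl
  have hba : √l ≤ √L := Real.sqrt_le_sqrt h.l_le
  have haκ : √L ≤ κ * √l := by
    have := h.one_le
    refine le_of_sq_le_sq ?_ (by positivity)
    rw [mul_pow, ha2, hb2, h.eq_mul]
    gcongr
    nlinarith
  -- The size of a first move against the allowed displacement: `√L * L ≤ κ² √l * l`, so the
  -- requirement `1024 κ² ε ≤ 1` is exactly what is used.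
  have hmove : 1.1 * √L * (ε * L) ≤ √l * l / 800 := by
    have h1 : √L * (ε * L) ≤ κ * √l * (ε * L) := by gcongr
    have h2 : κ * √l * (ε * L) = (κ ^ 2 * ε) * (√l * l) := by rw [h.eq_mul]; ring
    have h3 : 1024 * κ ^ 2 * ε * (√l * l) ≤ 1 * (√l * l) := by gcongr; exact h.ε_le
    nlinarith [mul_pos hb hl]
  have hinit : ∀ {p q : ℕ} {M : Matrix (Fin p) (Fin q) ℝ}, ‖M‖ ^ 2 ≤ (1 + ε) * L →
      ‖M‖ ≤ 1.001 * √L := fun {p q M} hM => by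
    refine le_of_sq_le_sq (hM.trans ?_) (by positivity)
    rw [mul_pow, ha2]
    gcongr
    linarith [h.ε_le_inv]
  have hwB0 : ∀ w, act P w = w → 0.995 * √l * ‖w‖ ≤ ‖act (B 0) w‖ := fun w hPw => by
    refine le_of_sq_le_sq (le_trans ?_ (hw w hPw)) (norm_nonneg _)
    rw [mul_pow, mul_pow, hb2]
    gcongr
    linarith [h.ε_le_inv]
  have hq0 := h.rate_nonneg
  have hq1 : 1 - η * l / 4 ≤ 1 := by nlinarith [mul_pos hη hl]
  -- The invariants must be carried together: contraction needs the factors near their start, and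
  -- that nearness needs the geometric decay of the residual.
  induction t with
  | zero => simpa using ⟨hBP, hE0⟩
  | succ t ih =>
    obtain ⟨ihP, ihE, ihA, ihB⟩ := ih
    set q := 1 - η * l / 4 with hq
    set E := A t * B t - Δ with hE
    have hqt : 0 ≤ q ^ t := pow_nonneg hq0 t
    have hqt1 : q ^ t ≤ 1 := pow_le_one₀ hq0 hq1
    have hsmall : √l / 200 * (1 - q ^ t) ≤ √l / 200 := by nlinarith
    have hEP : E * P = E := by rw [hE, Matrix.sub_mul, Matrix.mul_assoc, ihP, hΔP]
    have hnA : ‖A t‖ ≤ 1.01 * √L :=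
      (norm_le_of_sub (hinit hA0) (ihA.trans hsmall)).trans (by linarith)
    have hnB : ‖B t‖ ≤ 1.01 * √L :=
      (norm_le_of_sub (hinit hB0) (ihB.trans hsmall)).trans (by linarith)
    have hwB : ∀ w, act P w = w → 0.99 * √l * ‖w‖ ≤ ‖act (B t) w‖ := fun w hPw => by
      refine le_trans (le_of_eq ?_) (norm_act_ge_of_sub (hwB0 w hPw) (ihB.trans hsmall))
      ring
    have hα : (1.01 * √L) ^ 2 ≤ 1.03 * L := by rw [mul_pow, ha2]; linarith
    have hβ : 0.98 * l ≤ (0.99 * √l) ^ 2 := by rw [mul_pow, hb2]; linarith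
    have hβ' : (0.99 * √l) ^ 2 ≤ l := by rw [mul_pow, hb2]; linarith
    have hEε : ‖E‖ ≤ ε * L := ihE.trans (mul_le_of_le_one_left (by positivity) hqt1)
    have hηα : η * (1.01 * √L) ^ 2 ≤ 1 := by
      have := mul_le_mul_of_nonneg_left hα hη.le
      linarith [h.η_le']
    have hηβ : η * (0.99 * √l) ^ 2 ≤ 1 := by
      have := mul_le_mul_of_nonneg_left hβ' hη.le
      linarith [h.ηl_le, mul_pos hη hl]
    have hstep := norm_gd_residual_le hE.symm hP hEP hSig hη.le hnA hnB (by positivity) hwB hηα hηβ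
    rw [← hA, ← hB] at hstep
    have hstep' := hstep.trans
      (mul_le_mul_of_nonneg_right (h.factor_le hα hβ (norm_nonneg E) hEε) (norm_nonneg E))
    have hSE : ‖Sig * E‖ ≤ (1 + ε) * (q ^ t * (ε * L)) := norm_mul_le' (norm_le_one_add hSig) ihE
    -- The displacement bound telescopes: since `1 - q = ηl / 4`, its increment is `η q^t √l l /
    -- 800`, which dominates the length of the step.
    have hincr : η * ((1 + ε) * (q ^ t * (ε * L)) * (1.01 * √L))
        ≤ √l / 200 * (1 - q ^ (t + 1)) - √l / 200 * (1 - q ^ t) := by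
      have h1 : √l / 200 * (1 - q ^ (t + 1)) - √l / 200 * (1 - q ^ t)
          = η * q ^ t * (√l * l / 800) := by rw [pow_succ, hq]; ring
      rw [h1]
      have h2 : (1 + ε) * 1.01 ≤ 1.1 := by linarith [h.ε_le_inv]
      calc η * ((1 + ε) * (q ^ t * (ε * L)) * (1.01 * √L))
          = η * q ^ t * (((1 + ε) * 1.01) * √L * (ε * L)) := by ring
        _ ≤ η * q ^ t * (1.1 * √L * (ε * L)) := by gcongr
        _ ≤ _ := by gcongr
    refine ⟨?_, ?_, ?_, ?_⟩
    · rw [hB, Matrix.sub_mul, ihP, Matrix.smul_mul, Matrix.mul_assoc, Matrix.mul_assoc, hEP]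
    · refine hstep'.trans ?_
      rw [pow_succ', mul_assoc]
      gcongr
    · have hd : A (t + 1) - A 0 = (A t - A 0) - η • (Sig * E * (B t)ᵀ) := by rw [hA]; abel
      have hn : ‖Sig * E * (B t)ᵀ‖ ≤ (1 + ε) * (q ^ t * (ε * L)) * (1.01 * √L) :=
        norm_mul_le' hSE (by rwa [norm_transpose])
      rw [hd]
      refine (norm_sub_le _ _).trans ?_
      rw [norm_smul, Real.norm_of_nonneg hη.le]
      linarith [mul_le_mul_of_nonneg_left hn hη.le]
    · have hd : B (t + 1) - B 0 = (B t - B 0) - η • ((A t)ᵀ * (Sig * E)) := by rw [hB]; abel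
      have hn : ‖(A t)ᵀ * (Sig * E)‖ ≤ (1.01 * √L) * ((1 + ε) * (q ^ t * (ε * L))) :=
        norm_mul_le' (by rwa [norm_transpose]) hSE
      rw [hd]
      refine (norm_sub_le _ _).trans ?_
      rw [norm_smul, Real.norm_of_nonneg hη.le]
      linarith [mul_le_mul_of_nonneg_left hn hη.le]

end OperatorNorm

/-! ### Singular values, singular value decompositions and the row space -/

section SingularValues

open scoped Matrix.Norms.L2Operator

variable {m n d k r : ℕ}

theorem act_eq_toEuclideanLin (M : Matrix (Fin m) (Fin n) ℝ) (v : EuclideanSpace ℝ (Fin n)) :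
    act M v = Matrix.toEuclideanLin M v := rfl

/-- Parseval in an orthonormal eigenbasis of `T* T`, whose eigenvalues are the squared singular
values. -/
theorem norm_sq_eq_sum_singularValues {E F : Type*} [NormedAddCommGroup E]
    [InnerProductSpace ℝ E] [FiniteDimensional ℝ E] [NormedAddCommGroup F] [InnerProductSpace ℝ F]
    [FiniteDimensional ℝ F] (T : E →ₗ[ℝ] F) {n : ℕ} (hn : Module.finrank ℝ E = n) (v : E) :
    ‖T v‖ ^ 2 = ∑ i : Fin n, T.singularValues i ^ 2 *
      inner ℝ (T.isSymmetric_adjoint_comp_self.eigenvectorBasis hn i) v ^ 2 := by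
  set b := T.isSymmetric_adjoint_comp_self.eigenvectorBasis hn
  rw [← real_inner_self_eq_norm_sq, ← LinearMap.adjoint_inner_left, ← LinearMap.comp_apply,
    ← b.sum_inner_mul_inner]
  refine Finset.sum_congr rfl fun i _ => ?_
  rw [T.isSymmetric_adjoint_comp_self v, T.isSymmetric_adjoint_comp_self.apply_eigenvectorBasis,
    T.sq_singularValues_fin hn i, inner_smul_right, real_inner_comm v]
  simp only [RCLike.ofReal_real_eq_id, id, b]
  ring

theorem singularValues_eigenvector_norm {E F : Type*} [NormedAddCommGroup E]
    [InnerProductSpace ℝ E] [FiniteDimensional ℝ E] [NormedAddCommGroup F] [InnerProductSpace ℝ F]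
    [FiniteDimensional ℝ F] (T : E →ₗ[ℝ] F) {n : ℕ} (hn : Module.finrank ℝ E = n) (i : Fin n) :
    ‖T (T.isSymmetric_adjoint_comp_self.eigenvectorBasis hn i)‖ = T.singularValues i := by
  set b := T.isSymmetric_adjoint_comp_self.eigenvectorBasis hn with hb
  refine (sq_eq_sq₀ (norm_nonneg _) (T.singularValues_nonneg _)).1 ?_
  rw [norm_sq_eq_sum_singularValues T hn, Finset.sum_eq_single i]
  · simp [← hb, b.norm_eq_one]
  · intro j _ hj
    have := b.inner_eq_zero hj
    simp [← hb, this]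
  · simp

/-- The operator norm is at most the largest singular value. -/
theorem norm_le_sval_one (M : Matrix (Fin m) (Fin n) ℝ) : ‖M‖ ≤ sval M 1 := by
  have h0 : 0 ≤ sval M 1 := (Matrix.toEuclideanLin M).singularValues_nonneg _
  refine opNorm_le_of_act _ h0 fun v => le_of_sq_le_sq ?_ (by positivity)
  have hn : Module.finrank ℝ (EuclideanSpace ℝ (Fin n)) = n := by simp
  rw [act_eq_toEuclideanLin, norm_sq_eq_sum_singularValues _ hn, mul_pow,
    ← ((Matrix.toEuclideanLin M).isSymmetric_adjoint_comp_self.eigenvectorBasis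
      hn).sum_sq_inner_right v, Finset.mul_sum]
  refine Finset.sum_le_sum fun i _ => ?_
  gcongr
  · exact (Matrix.toEuclideanLin M).singularValues_nonneg _
  · exact (Matrix.toEuclideanLin M).singularValues_antitone (Nat.zero_le _)

theorem finrank_range_toEuclideanLin (M : Matrix (Fin m) (Fin n) ℝ) :
    Module.finrank ℝ (Matrix.toEuclideanLin M).range = M.rank := by
  rw [Matrix.rank_eq_finrank_range_toLin M (EuclideanSpace.basisFun (Fin m) ℝ).toBasis
    (EuclideanSpace.basisFun (Fin n) ℝ).toBasis, Matrix.toEuclideanLin_eq_toLin_orthonormal]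

theorem sval_rank_pos (M : Matrix (Fin m) (Fin n) ℝ) (h : 0 < M.rank) : 0 < sval M M.rank := by
  rw [sval, LinearMap.singularValues_pos_iff_lt_finrank_range, finrank_range_toEuclideanLin]
  omega

theorem sval_rank_le_sval_one (M : Matrix (Fin m) (Fin n) ℝ) : sval M M.rank ≤ sval M 1 :=
  (Matrix.toEuclideanLin M).singularValues_antitone (by simp)

/-- On the orthogonal complement of its kernel, a matrix stretches by at least its smallest
nonzero singular value. -/
theorem sval_rank_mul_norm_le (M : Matrix (Fin m) (Fin n) ℝ) (v : EuclideanSpace ℝ (Fin n))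
    (hv : ∀ w, act M w = 0 → inner ℝ w v = 0) : sval M M.rank * ‖v‖ ≤ ‖act M v‖ := by
  have hn : Module.finrank ℝ (EuclideanSpace ℝ (Fin n)) = n := by simp
  refine le_of_sq_le_sq ?_ (norm_nonneg _)
  rw [act_eq_toEuclideanLin, norm_sq_eq_sum_singularValues _ hn, mul_pow,
    ← ((Matrix.toEuclideanLin M).isSymmetric_adjoint_comp_self.eigenvectorBasis
      hn).sum_sq_inner_right v, Finset.mul_sum]
  refine Finset.sum_le_sum fun i _ => ?_
  by_cases hi : (i : ℕ) < M.rank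
  · gcongr
    · exact (Matrix.toEuclideanLin M).singularValues_nonneg _
    · exact (Matrix.toEuclideanLin M).singularValues_antitone (by omega)
  · have h0 : (Matrix.toEuclideanLin M).singularValues i = 0 := by
      rw [LinearMap.singularValues_eq_zero_iff_le_finrank_range, finrank_range_toEuclideanLin]
      omega
    -- Eigenvectors with index at least the rank lie in the kernel, so `v` has no component along
    -- them.
    rw [hv _ (by rw [← norm_eq_zero, act_eq_toEuclideanLin,
      singularValues_eigenvector_norm _ hn, h0])]
    simp

theorem norm_act_sq (M : Matrix (Fin m) (Fin n) ℝ) (w : EuclideanSpace ℝ (Fin n)) :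
    ‖act M w‖ ^ 2 = inner ℝ w (act (Mᵀ * M) w) := by
  rw [← real_inner_self_eq_norm_sq, inner_act, act_mul]

theorem inner_act_diagonal (s : Fin n → ℝ) (u : EuclideanSpace ℝ (Fin n)) :
    inner ℝ u (act (Matrix.diagonal s) u) = ∑ j, s j * u j ^ 2 := by
  rw [PiLp.inner_apply]
  refine Finset.sum_congr rfl fun j _ => ?_
  simp [act, Matrix.mulVec_diagonal]
  ring

theorem norm_le_one_of_transpose_mul_self {M : Matrix (Fin m) (Fin n) ℝ} (h : Mᵀ * M = 1) :
    ‖M‖ ≤ 1 := by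
  have h1 := norm_transpose_mul_self M
  rw [h] at h1
  have := norm_one_matrix_le (n := n)
  nlinarith [norm_nonneg M]

theorem sum_castLE {r n : ℕ} (h : r ≤ n) (f : Fin n → ℝ) (hf : ∀ j : Fin n, r ≤ j → f j = 0) :
    ∑ i : Fin r, f (Fin.castLE h i) = ∑ j, f j := by
  refine Fintype.sum_of_injective (Fin.castLE h) (Fin.castLE_injective h) _ _ (fun j hj => ?_)
    fun _ => rfl
  refine hf j (not_lt.1 fun hlt => hj ⟨⟨j, hlt⟩, rfl⟩)

/-- The diagonal entry of a rectangular matrix in a given column. -/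
def diagEntry (S : Matrix (Fin d) (Fin k) ℝ) (j : Fin k) : ℝ :=
  if h : (j : ℕ) < d then S ⟨j, h⟩ j else 0

theorem sum_mul_rectDiagonal {S : Matrix (Fin d) (Fin k) ℝ}
    (hS : ∀ (i : Fin d) (j : Fin k), (i : ℕ) ≠ (j : ℕ) → S i j = 0) (f : Fin d → ℝ) (j : Fin k) :
    ∑ i, f i * S i j = if h : (j : ℕ) < d then f ⟨j, h⟩ * diagEntry S j else 0 := by
  split_ifs with h
  · rw [Finset.sum_eq_single ⟨j, h⟩]
    · simp [diagEntry, h]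
    · intro i _ hi
      rw [hS i j (fun hij => hi (Fin.ext hij)), mul_zero]
    · simp
  · refine Finset.sum_eq_zero fun i _ => ?_
    rw [hS i j (by have := i.2; omega), mul_zero]

variable {G : Matrix (Fin d) (Fin k) ℝ} {U : Matrix (Fin d) (Fin d) ℝ}
  {S : Matrix (Fin d) (Fin k) ℝ} {V : Matrix (Fin k) (Fin k) ℝ}

namespace IsSVD

theorem left_transpose_mul (h : IsSVD G U S V) : Uᵀ * U = 1 :=
  (Matrix.mem_orthogonalGroup_iff' (Fin d) ℝ).1 h.left_orthogonal

theorem right_transpose_mul (h : IsSVD G U S V) : Vᵀ * V = 1 :=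
  (Matrix.mem_orthogonalGroup_iff' (Fin k) ℝ).1 h.right_orthogonal

theorem right_mul_transpose (h : IsSVD G U S V) : V * Vᵀ = 1 :=
  (Matrix.mem_orthogonalGroup_iff (Fin k) ℝ).1 h.right_orthogonal

theorem diagEntry_nonneg (h : IsSVD G U S V) (j : Fin k) : 0 ≤ diagEntry S j := by
  unfold diagEntry
  split_ifs
  exacts [h.nonneg _ _, le_rfl]

theorem diagEntry_ne_zero_of_le (h : IsSVD G U S V) {i j : Fin k} (hij : i ≤ j)
    (hj : diagEntry S j ≠ 0) : diagEntry S i ≠ 0 := by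
  have hjd : (j : ℕ) < d := by
    by_contra hjd
    exact hj (by simp [diagEntry, hjd])
  have hij' : (i : ℕ) ≤ j := hij
  have hid : (i : ℕ) < d := by omega
  have hj0 := (h.diagEntry_nonneg j).lt_of_ne' hj
  have := h.sorted ⟨i, hid⟩ ⟨j, hjd⟩ i j rfl rfl hij
  simp only [diagEntry, hid, hjd, dite_true] at hj0 ⊢
  exact (hj0.trans_le this).ne'

theorem transpose_mul_self (h : IsSVD G U S V) :
    Sᵀ * S = Matrix.diagonal fun j => diagEntry S j ^ 2 := by
  ext i j
  rw [Matrix.mul_apply, Matrix.diagonal_apply]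
  simp only [Matrix.transpose_apply]
  rw [sum_mul_rectDiagonal h.diagonal]
  by_cases hj : (j : ℕ) < d
  · by_cases hij : i = j
    · subst hij
      simp [hj, diagEntry, sq]
    · have : S ⟨j, hj⟩ i = 0 := h.diagonal _ _ (fun hc => hij (Fin.ext hc.symm))
      simp [hj, hij, this]
  · by_cases hij : i = j
    · subst hij
      simp [hj, diagEntry]
    · simp [hj, hij]

theorem gram (h : IsSVD G U S V) :
    Gᵀ * G = V * (Matrix.diagonal fun j => diagEntry S j ^ 2) * Vᵀ := by
  rw [← h.transpose_mul_self, h.eq_mul]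
  simp only [Matrix.transpose_mul, Matrix.transpose_transpose, Matrix.mul_assoc]
  rw [← Matrix.mul_assoc Uᵀ, h.left_transpose_mul, Matrix.one_mul]

/-- The `j`-th right singular vector. -/
noncomputable def _root_.LoRA.rightVec (V : Matrix (Fin k) (Fin k) ℝ) (j : Fin k) :
    EuclideanSpace ℝ (Fin k) :=
  act V (EuclideanSpace.single j 1)

theorem act_transpose_rightVec (h : IsSVD G U S V) (j : Fin k) :
    act Vᵀ (rightVec V j) = EuclideanSpace.single j 1 := by
  rw [rightVec, ← act_mul, h.right_transpose_mul, act_one]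

theorem norm_rightVec (h : IsSVD G U S V) (j : Fin k) : ‖rightVec V j‖ = 1 := by
  refine (sq_eq_sq₀ (norm_nonneg _) zero_le_one).1 ?_
  rw [rightVec, norm_act_sq, h.right_transpose_mul, act_one]
  simp

theorem act_gram_rightVec (h : IsSVD G U S V) (j : Fin k) :
    act (Gᵀ * G) (rightVec V j) = diagEntry S j ^ 2 • rightVec V j := by
  rw [h.gram, act_mul, h.act_transpose_rightVec, act_mul, rightVec]
  have : act (Matrix.diagonal fun j => diagEntry S j ^ 2) (EuclideanSpace.single j (1 : ℝ))
      = diagEntry S j ^ 2 • EuclideanSpace.single j (1 : ℝ) := by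
    ext i
    simp [act]
  rw [this]
  simp [act, Matrix.mulVec_smul]

theorem norm_act_rightVec (h : IsSVD G U S V) (j : Fin k) :
    ‖act G (rightVec V j)‖ = diagEntry S j := by
  refine (sq_eq_sq₀ (norm_nonneg _) (h.diagEntry_nonneg j)).1 ?_
  rw [norm_act_sq, h.act_gram_rightVec, inner_smul_right, real_inner_self_eq_norm_sq,
    h.norm_rightVec]
  simp

theorem diagEntry_le_norm (h : IsSVD G U S V) (j : Fin k) : diagEntry S j ≤ ‖G‖ := by
  rw [← h.norm_act_rightVec j]
  simpa [h.norm_rightVec] using norm_act_le G (rightVec V j)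

/-- Right singular vectors with nonzero singular value are orthogonal to the kernel. -/
theorem inner_rightVec_eq_zero (h : IsSVD G U S V) {j : Fin k} (hj : diagEntry S j ≠ 0)
    {w : EuclideanSpace ℝ (Fin k)} (hw : act G w = 0) : inner ℝ w (rightVec V j) = 0 := by
  have h1 : inner ℝ (act G w) (act G (rightVec V j)) = 0 := by rw [hw, inner_zero_left]
  rw [inner_act, ← act_mul, h.act_gram_rightVec, inner_smul_right] at h1
  exact (mul_eq_zero.1 h1).resolve_left (pow_ne_zero 2 hj)

/-- `VᵀGᵀGV` is the diagonal matrix of squared entries; its rank counts the nonzero ones and cannot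
exceed that of `G`. -/
theorem card_diagEntry_ne_zero_le (h : IsSVD G U S V) :
    Fintype.card {j // diagEntry S j ≠ 0} ≤ G.rank := by
  have h1 : Matrix.diagonal (fun j => diagEntry S j ^ 2) = Vᵀ * (Gᵀ * (G * V)) := by
    rw [← Matrix.mul_assoc Gᵀ, h.gram, Matrix.mul_assoc _ Vᵀ, h.right_transpose_mul,
      Matrix.mul_one, ← Matrix.mul_assoc, h.right_transpose_mul, Matrix.one_mul]
  have h2 : (Matrix.diagonal (fun j => diagEntry S j ^ 2)).rank ≤ G.rank := by
    rw [h1]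
    exact (Matrix.rank_mul_le_right _ _).trans
      ((Matrix.rank_mul_le_right _ _).trans (Matrix.rank_mul_le_left _ _))
  rw [Matrix.rank_diagonal] at h2
  simpa using h2

theorem diagEntry_eq_zero (h : IsSVD G U S V) {j : Fin k} (hj : G.rank ≤ j) :
    diagEntry S j = 0 := by
  by_contra hne
  -- By monotonicity a nonzero entry at `j` forces the `j + 1` entries up to `j` to be nonzero, more
  -- than the rank permits.
  have h1 : Fintype.card (Fin (j + 1)) ≤ Fintype.card {j // diagEntry S j ≠ 0} :=
    Fintype.card_le_of_injective (fun i : Fin (j + 1) =>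
      (⟨⟨i, by omega⟩, h.diagEntry_ne_zero_of_le (Fin.le_def.2 (by simp; omega)) hne⟩ :
        {j // diagEntry S j ≠ 0})) fun a b hab => by
          simpa [Fin.ext_iff] using hab
  have := h.card_diagEntry_ne_zero_le
  simp only [Fintype.card_fin] at h1
  omega

end IsSVD

/-- The orthogonal projection onto the span of the right singular vectors with nonzero singular
value. -/
noncomputable def rowProj (S : Matrix (Fin d) (Fin k) ℝ) (V : Matrix (Fin k) (Fin k) ℝ) :
    Matrix (Fin k) (Fin k) ℝ :=
  V * (Matrix.diagonal fun j => if diagEntry S j = 0 then (0 : ℝ) else 1) * Vᵀ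

theorem rowProj_transpose (S : Matrix (Fin d) (Fin k) ℝ) (V : Matrix (Fin k) (Fin k) ℝ) :
    (rowProj S V)ᵀ = rowProj S V := by
  simp [rowProj, Matrix.transpose_mul, Matrix.mul_assoc]

theorem frobNorm_sq (M : Matrix (Fin m) (Fin n) ℝ) : frobNorm M ^ 2 = (M * Mᵀ).trace := by
  rw [frobNorm, Real.sq_sqrt (by positivity), Matrix.trace]
  simp [Matrix.mul_apply, sq]

theorem frobNorm_sq' (M : Matrix (Fin m) (Fin n) ℝ) :
    frobNorm M ^ 2 = ∑ j, ‖act M (EuclideanSpace.single j 1)‖ ^ 2 := by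
  rw [frobNorm, Real.sq_sqrt (by positivity), Finset.sum_comm]
  refine Finset.sum_congr rfl fun j _ => ?_
  rw [EuclideanSpace.norm_sq_eq]
  simp [act]

namespace IsSVD

theorem mul_rowProj (h : IsSVD G U S V) : G * rowProj S V = G := by
  have h1 : S * (Matrix.diagonal fun j => if diagEntry S j = 0 then (0 : ℝ) else 1) = S := by
    ext i j
    rw [Matrix.mul_diagonal]
    by_cases hij : (i : ℕ) = j
    · have hd : diagEntry S j = S i j := by
        have : (j : ℕ) < d := hij ▸ i.2
        simp only [diagEntry, this, dite_true]
        congr 1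
        exact Fin.ext hij.symm
      by_cases h0 : S i j = 0 <;> simp [hd, h0]
    · simp [h.diagonal i j hij]
  have h2 : G * V = U * S := by
    rw [h.eq_mul, Matrix.mul_assoc, h.right_transpose_mul, Matrix.mul_one]
  rw [rowProj, ← Matrix.mul_assoc, ← Matrix.mul_assoc, h2, Matrix.mul_assoc U, h1, ← h.eq_mul]

/-- The Frobenius norm of a matrix whose rows lie in the row space of `G`. -/
theorem frobNorm_le (h : IsSVD G U S V) {E : Matrix (Fin m) (Fin k) ℝ} (hE : E * rowProj S V = E) :
    frobNorm E ≤ √G.rank * ‖E‖ := by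
  refine le_of_sq_le_sq ?_ (by positivity)
  have h0 : frobNorm E ^ 2 = frobNorm (E * V) ^ 2 := by
    rw [frobNorm_sq, frobNorm_sq, Matrix.transpose_mul, Matrix.mul_assoc, ← Matrix.mul_assoc V,
      h.right_mul_transpose, Matrix.one_mul]
  have h1 : E * V = E * V * (Matrix.diagonal fun j => if diagEntry S j = 0 then (0 : ℝ) else 1) := by
    conv_lhs => rw [← hE]
    rw [rowProj, Matrix.mul_assoc, Matrix.mul_assoc _ Vᵀ, h.right_transpose_mul, Matrix.mul_one,
      Matrix.mul_assoc]
  -- Column `j` of `EV` is `E` applied to the `j`-th right singular vector; it vanishes when the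
  -- singular value does, so at most `rank G` columns contribute.
  have h2 : ∀ j, ‖act (E * V) (EuclideanSpace.single j 1)‖ ^ 2
      ≤ if diagEntry S j = 0 then 0 else ‖E‖ ^ 2 := fun j => by
    split_ifs with hj
    · rw [h1, act_mul]
      have : act (Matrix.diagonal fun j => if diagEntry S j = 0 then (0 : ℝ) else 1)
          (EuclideanSpace.single j (1 : ℝ)) = 0 := by
        ext i
        simp [act, hj]
      rw [this]
      simp [act]
    · rw [act_mul]
      gcongr
      have h3 := norm_act_le E (rightVec V j)
      rwa [h.norm_rightVec, mul_one] at h3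
  rw [h0, frobNorm_sq', mul_pow, Real.sq_sqrt (by positivity)]
  refine (Finset.sum_le_sum fun j _ => h2 j).trans ?_
  have h3 := h.card_diagEntry_ne_zero_le
  rw [Fintype.card_subtype] at h3
  have h4 : (∑ j, if diagEntry S j = 0 then (0 : ℝ) else ‖E‖ ^ 2)
      = ((Finset.univ.filter fun j => diagEntry S j ≠ 0).card : ℝ) * ‖E‖ ^ 2 := by
    rw [← nsmul_eq_mul, ← Finset.sum_const, Finset.sum_filter]
    simp
  rw [h4]
  gcongr

variable {hrd : r ≤ d} {hrk : r ≤ k}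

theorem sqrtBlock_eq (h : IsSVD G U S V) :
    (S.map Real.sqrt).submatrix (Fin.castLE hrd) (Fin.castLE hrk)
      = Matrix.diagonal fun i : Fin r => √(diagEntry S (Fin.castLE hrk i)) := by
  ext i j
  rw [Matrix.diagonal_apply]
  split_ifs with hij
  · subst hij
    have : (i : ℕ) < d := i.2.trans_le hrd
    simp only [Matrix.submatrix_apply, Matrix.map_apply, diagEntry, Fin.val_castLE, this,
      dite_true]
    rfl
  · simp only [Matrix.submatrix_apply, Matrix.map_apply]
    rw [h.diagonal _ _ (by simpa [Fin.ext_iff] using hij), Real.sqrt_zero]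

theorem norm_sqrtBlock_le (h : IsSVD G U S V) :
    ‖Matrix.diagonal fun i : Fin r => √(diagEntry S (Fin.castLE hrk i))‖ ≤ √‖G‖ := by
  rw [Matrix.l2_opNorm_diagonal]
  refine (pi_norm_le_iff_of_nonneg (by positivity)).2 fun i => ?_
  rw [Real.norm_of_nonneg (by positivity)]
  exact Real.sqrt_le_sqrt (h.diagEntry_le_norm _)

theorem _root_.LoRA.norm_submatrix_castLE_le {W : Matrix (Fin n) (Fin n) ℝ} (hW : Wᵀ * W = 1)
    (hrn : r ≤ n) : ‖W.submatrix id (Fin.castLE hrn)‖ ≤ 1 := by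
  refine norm_le_one_of_transpose_mul_self ?_
  have h1 : (W.submatrix id (Fin.castLE hrn))ᵀ * W.submatrix id (Fin.castLE hrn)
      = (Wᵀ * W).submatrix (Fin.castLE hrn) (Fin.castLE hrn) := by
    ext i j
    simp [Matrix.mul_apply]
  rw [h1, hW, Matrix.submatrix_one _ (Fin.castLE_injective hrn)]

end IsSVD

/-! ### The spectral initialization: norms, product and coercivity -/

/-- The spectral initialization attached to a singular value decomposition, with the diagonal
block written as a diagonal matrix. -/
theorem IsSpectralInit.exists_diagonal {hrd : r ≤ d} {hrk : r ≤ k}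
    {A₀ : Matrix (Fin d) (Fin r) ℝ} {B₀ : Matrix (Fin r) (Fin k) ℝ}
    (h : IsSpectralInit hrd hrk G A₀ B₀) :
    ∃ U S V, IsSVD G U S V ∧
      A₀ = U.submatrix id (Fin.castLE hrd) *
        (Matrix.diagonal fun i : Fin r => √(diagEntry S (Fin.castLE hrk i))) ∧
      B₀ = (Matrix.diagonal fun i : Fin r => √(diagEntry S (Fin.castLE hrk i))) *
        (V.submatrix id (Fin.castLE hrk))ᵀ := by
  obtain ⟨U, S, V, hS, hA, hB⟩ := h
  rw [hS.sqrtBlock_eq] at hA hB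
  exact ⟨U, S, V, hS, hA, hB⟩

section SpectralInit

variable {hrd : r ≤ d} {hrk : r ≤ k} {A₀ : Matrix (Fin d) (Fin r) ℝ}
  {B₀ : Matrix (Fin r) (Fin k) ℝ}

theorem IsSVD.norm_init_left_sq_le (h : IsSVD G U S V)
    (hA : A₀ = U.submatrix id (Fin.castLE hrd) *
      (Matrix.diagonal fun i : Fin r => √(diagEntry S (Fin.castLE hrk i)))) :
    ‖A₀‖ ^ 2 ≤ ‖G‖ := by
  have h1 : ‖A₀‖ ≤ 1 * √‖G‖ := by
    rw [hA]
    exact norm_mul_le' (norm_submatrix_castLE_le h.left_transpose_mul hrd) h.norm_sqrtBlock_le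
  calc ‖A₀‖ ^ 2 ≤ (1 * √‖G‖) ^ 2 := by gcongr
    _ = ‖G‖ := by rw [one_mul, Real.sq_sqrt (norm_nonneg _)]

theorem IsSVD.norm_init_right_sq_le (h : IsSVD G U S V)
    (hB : B₀ = (Matrix.diagonal fun i : Fin r => √(diagEntry S (Fin.castLE hrk i))) *
      (V.submatrix id (Fin.castLE hrk))ᵀ) : ‖B₀‖ ^ 2 ≤ ‖G‖ := by
  have h1 : ‖B₀‖ ≤ √‖G‖ * 1 := by
    rw [hB]
    refine norm_mul_le' h.norm_sqrtBlock_le ?_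
    rw [norm_transpose]
    exact norm_submatrix_castLE_le h.right_transpose_mul hrk
  calc ‖B₀‖ ^ 2 ≤ (√‖G‖ * 1) ^ 2 := by gcongr
    _ = ‖G‖ := by rw [mul_one, Real.sq_sqrt (norm_nonneg _)]

/-- If the rank of the initialization is at least that of `G`, the product of the factors
is `G`. -/
theorem IsSVD.init_mul (h : IsSVD G U S V) (hr : G.rank ≤ r)
    (hA : A₀ = U.submatrix id (Fin.castLE hrd) *
      (Matrix.diagonal fun i : Fin r => √(diagEntry S (Fin.castLE hrk i))))
    (hB : B₀ = (Matrix.diagonal fun i : Fin r => √(diagEntry S (Fin.castLE hrk i))) *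
      (V.submatrix id (Fin.castLE hrk))ᵀ) : A₀ * B₀ = G := by
  ext a b
  have hU : ∀ j : Fin k, (U * S) a j
      = if hj : (j : ℕ) < d then U a ⟨j, hj⟩ * diagEntry S j else 0 := fun j => by
    rw [Matrix.mul_apply, sum_mul_rectDiagonal h.diagonal]
  rw [h.eq_mul, Matrix.mul_apply, Matrix.mul_apply, ← sum_castLE hrk]
  · refine Finset.sum_congr rfl fun i _ => ?_
    have hi : (i : ℕ) < d := i.2.trans_le hrd
    rw [hU, hA, hB, Matrix.mul_diagonal, Matrix.diagonal_mul]
    simp only [Matrix.submatrix_apply, Matrix.transpose_apply, Fin.val_castLE, hi, dite_true, id]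
    have hs := Real.mul_self_sqrt (h.diagEntry_nonneg (Fin.castLE hrk i))
    have hc : Fin.castLE hrd i = ⟨i, hi⟩ := rfl
    rw [hc]
    linear_combination (U a ⟨i, hi⟩ * V b (Fin.castLE hrk i)) * hs
  · intro j hj
    rw [hU, h.diagEntry_eq_zero (hr.trans hj)]
    simp

/-- The Gram matrix of `B₀` is the positive square root of `GᵀG`, so `‖B₀ w‖²` is governed by the
singular values themselves. Truncation at `r` loses nothing, as the later entries vanish. -/
theorem IsSVD.init_right_gram (h : IsSVD G U S V) (hr : G.rank ≤ r)
    (hB : B₀ = (Matrix.diagonal fun i : Fin r => √(diagEntry S (Fin.castLE hrk i))) *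
      (V.submatrix id (Fin.castLE hrk))ᵀ) :
    B₀ᵀ * B₀ = V * Matrix.diagonal (diagEntry S) * Vᵀ := by
  ext a b
  rw [Matrix.mul_apply, Matrix.mul_apply, ← sum_castLE hrk]
  · refine Finset.sum_congr rfl fun i _ => ?_
    rw [hB, Matrix.transpose_apply, Matrix.diagonal_mul, Matrix.diagonal_mul, Matrix.mul_diagonal]
    simp only [Matrix.submatrix_apply, Matrix.transpose_apply, id]
    have hs := Real.mul_self_sqrt (h.diagEntry_nonneg (Fin.castLE hrk i))
    linear_combination (V a (Fin.castLE hrk i) * V b (Fin.castLE hrk i)) * hs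
  · intro j hj
    rw [Matrix.mul_diagonal, h.diagEntry_eq_zero (hr.trans hj)]
    simp

theorem IsSVD.init_right_mul_rowProj (h : IsSVD G U S V)
    (hB : B₀ = (Matrix.diagonal fun i : Fin r => √(diagEntry S (Fin.castLE hrk i))) *
      (V.submatrix id (Fin.castLE hrk))ᵀ) : B₀ * rowProj S V = B₀ := by
  have h1 : B₀ * V = Matrix.of fun i j =>
      √(diagEntry S (Fin.castLE hrk i)) * (1 : Matrix (Fin k) (Fin k) ℝ) (Fin.castLE hrk i) j := by
    ext i j
    rw [← h.right_transpose_mul, hB, Matrix.mul_assoc, Matrix.diagonal_mul, Matrix.mul_apply,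
      Matrix.of_apply, Matrix.mul_apply]
    rfl
  have h2 : B₀ * V * (Matrix.diagonal fun j => if diagEntry S j = 0 then (0 : ℝ) else 1) = B₀ * V := by
    rw [h1]
    ext i j
    rw [Matrix.mul_diagonal, Matrix.of_apply, Matrix.one_apply]
    by_cases hij : Fin.castLE hrk i = j
    · subst hij
      by_cases h0 : diagEntry S (Fin.castLE hrk i) = 0 <;> simp [h0]
    · simp [hij]
  rw [rowProj, ← Matrix.mul_assoc, ← Matrix.mul_assoc, h2, Matrix.mul_assoc,
    h.right_mul_transpose, Matrix.mul_one]

theorem IsSVD.init_right_coercive (h : IsSVD G U S V) (hr : G.rank ≤ r)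
    (hB : B₀ = (Matrix.diagonal fun i : Fin r => √(diagEntry S (Fin.castLE hrk i))) *
      (V.submatrix id (Fin.castLE hrk))ᵀ) {b : ℝ} (hb : ∀ j, diagEntry S j ≠ 0 → b ≤ diagEntry S j)
    (w : EuclideanSpace ℝ (Fin k)) (hw : act (rowProj S V) w = w) :
    b * ‖w‖ ^ 2 ≤ ‖act B₀ w‖ ^ 2 := by
  have h1 : ∀ s : Fin k → ℝ, inner ℝ w (act (V * Matrix.diagonal s * Vᵀ) w)
      = ∑ j, s j * act Vᵀ w j ^ 2 := fun s => by
    rw [← inner_act_diagonal, Matrix.mul_assoc, act_mul, act_mul]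
    conv_lhs => rw [← V.transpose_transpose, ← inner_act, V.transpose_transpose]
  have h2 : ‖w‖ ^ 2 = ∑ j, (if diagEntry S j = 0 then (0 : ℝ) else 1) * act Vᵀ w j ^ 2 := by
    rw [← h1, ← real_inner_self_eq_norm_sq]
    conv_lhs => arg 3; rw [← hw]
    rfl
  rw [norm_act_sq, h.init_right_gram hr hB, h1, h2, Finset.mul_sum]
  refine Finset.sum_le_sum fun j _ => ?_
  split_ifs with hj
  · simp [hj]
  · rw [one_mul]
    gcongr
    exact hb j hj

end SpectralInit

/-- Multiplication by a matrix near the identity preserves lower bounds. -/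
theorem one_sub_mul_norm_le {Sig : Matrix (Fin d) (Fin d) ℝ} {ε : ℝ} (hSig : ‖Sig - 1‖ ≤ ε)
    (v : EuclideanSpace ℝ (Fin d)) : (1 - ε) * ‖v‖ ≤ ‖act Sig v‖ :=
  norm_act_ge_of_sub (M₀ := 1) (by rw [act_one, one_mul]) hSig

theorem act_eq_zero_of_act_mul_eq_zero {Sig : Matrix (Fin d) (Fin d) ℝ}
    {Δ : Matrix (Fin d) (Fin k) ℝ} {ε : ℝ} (hSig : ‖Sig - 1‖ ≤ ε) (hε : ε < 1)
    {w : EuclideanSpace ℝ (Fin k)} (hw : act (Sig * Δ) w = 0) : act Δ w = 0 := by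
  have h1 := one_sub_mul_norm_le hSig (act Δ w)
  rw [← act_mul, hw, norm_zero] at h1
  rw [← norm_eq_zero]
  nlinarith [norm_nonneg (act Δ w)]

/-- A right singular vector with nonzero value is orthogonal to the kernel of `Sig * Δ`, hence to
that of `Δ`. So `Δ` stretches it by at least its smallest nonzero singular value, and `Sig` loses at
most a factor `1 - ε`. -/
theorem IsSVD.le_diagEntry {Sig : Matrix (Fin d) (Fin d) ℝ} {Δ : Matrix (Fin d) (Fin k) ℝ}
    (h : IsSVD (Sig * Δ) U S V) {ε : ℝ} (hSig : ‖Sig - 1‖ ≤ ε) (hε : ε < 1) (j : Fin k)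
    (hj : diagEntry S j ≠ 0) : (1 - ε) * sval Δ Δ.rank ≤ diagEntry S j := by
  rw [← h.norm_act_rightVec j, act_mul]
  refine le_trans ?_ (one_sub_mul_norm_le hSig _)
  have hε' : 0 ≤ 1 - ε := by linarith
  gcongr
  have := sval_rank_mul_norm_le Δ (rightVec V j) fun w hw => h.inner_rightVec_eq_zero hj (by
    rw [act_mul, hw]; simp [act])
  simpa [h.norm_rightVec] using this

/-- As `ε < 1`, `Sig` is injective, so `Sig * Δ` and `Δ` have the same kernel; `Pv - v` lies in the
former for every `v`, where `P` is the row projection. -/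
theorem IsSVD.mul_rowProj_of_mul {Sig : Matrix (Fin d) (Fin d) ℝ} {Δ : Matrix (Fin d) (Fin k) ℝ}
    (h : IsSVD (Sig * Δ) U S V) {ε : ℝ} (hSig : ‖Sig - 1‖ ≤ ε) (hε : ε < 1) :
    Δ * rowProj S V = Δ := by
  have h1 : Δ * rowProj S V - Δ = 0 := by
    rw [← norm_le_zero_iff]
    refine opNorm_le_of_act _ le_rfl fun v => ?_
    have h2 : act Δ (act (rowProj S V) v - v) = 0 := by
      refine act_eq_zero_of_act_mul_eq_zero hSig hε ?_
      have h3 : ∀ M : Matrix (Fin d) (Fin k) ℝ,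
          act M (act (rowProj S V) v - v) = act (M * rowProj S V - M) v := fun M => by
        simp [act, Matrix.mulVec_sub, Matrix.sub_mulVec]
      rw [h3, h.mul_rowProj, sub_self]
      simp [act]
    have h3 : act (Δ * rowProj S V - Δ) v = act Δ (act (rowProj S V) v - v) := by
      simp [act, Matrix.mulVec_sub, Matrix.sub_mulVec]
    rw [h3, h2]
    simp
  exact sub_eq_zero.1 h1

end SingularValues

/-! ### Gradients of the two losses -/

section Gradients

variable {m n N d k r : ℕ}

/-- The common source of all three gradients: in each, the residual is affine in the perturbed
entry. -/
theorem deriv_frobNorm_sq (c : ℝ) (R D : Matrix (Fin m) (Fin n) ℝ) :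
    deriv (fun s : ℝ => c * frobNorm (R + s • D) ^ 2) 0 = 2 * c * (Rᵀ * D).trace := by
  have h1 : ∀ s : ℝ, frobNorm (R + s • D) ^ 2 = ∑ i, ∑ j, (R i j + s * D i j) ^ 2 := fun s => by
    rw [frobNorm, Real.sq_sqrt (by positivity)]
    simp
  have h2 : HasDerivAt (fun s : ℝ => ∑ i, ∑ j, (R i j + s * D i j) ^ 2)
      (∑ i, ∑ j, 2 * R i j * D i j) 0 := by
    refine HasDerivAt.fun_sum fun i _ => HasDerivAt.fun_sum fun j _ => ?_
    have h3 : HasDerivAt (fun s : ℝ => R i j + s * D i j) (D i j) 0 := by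
      simpa using ((hasDerivAt_id (0 : ℝ)).mul_const (D i j)).const_add (R i j)
    simpa using h3.fun_pow 2
  simp_rw [h1]
  rw [(h2.const_mul c).deriv, Matrix.trace, Finset.sum_comm, Finset.mul_sum, Finset.mul_sum]
  refine Finset.sum_congr rfl fun j _ => ?_
  rw [Matrix.diag_apply, Matrix.mul_apply, Finset.mul_sum, Finset.mul_sum]
  refine Finset.sum_congr rfl fun i _ => ?_
  rw [Matrix.transpose_apply]
  ring

theorem trace_mul_single_one (M : Matrix (Fin n) (Fin m) ℝ) (i : Fin m) (j : Fin n) :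
    (M * Matrix.single i j (1 : ℝ)).trace = Mᵀ i j := by
  rw [Matrix.trace_mul_single]
  simp

theorem oneStepGrad_eq (X : Matrix (Fin N) (Fin d) ℝ) (W₀ Δ : Matrix (Fin d) (Fin k) ℝ) :
    oneStepGrad X (X * (W₀ + Δ)) W₀ = empCov X * Δ := by
  ext i j
  have h1 : ∀ s : ℝ, X * (W₀ + s • Matrix.single i j (1 : ℝ)) - X * (W₀ + Δ)
      = -(X * Δ) + s • (X * Matrix.single i j (1 : ℝ)) := fun s => by
    simp only [Matrix.mul_add, Matrix.mul_smul]
    abel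
  rw [oneStepGrad, Matrix.neg_apply, matGrad, Matrix.of_apply]
  simp only [fullLoss, h1]
  rw [deriv_frobNorm_sq, ← Matrix.mul_assoc, trace_mul_single_one]
  simp only [empCov, Matrix.transpose_mul, Matrix.transpose_transpose, Matrix.transpose_neg,
    Matrix.neg_mul, Matrix.neg_apply, Matrix.smul_mul, Matrix.smul_apply, smul_eq_mul,
    Matrix.mul_assoc]
  ring

theorem matGrad_loraLoss_left (X : Matrix (Fin N) (Fin d) ℝ) (W₀ Δ : Matrix (Fin d) (Fin k) ℝ)
    (A : Matrix (Fin d) (Fin r) ℝ) (B : Matrix (Fin r) (Fin k) ℝ) :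
    matGrad (fun A' => loraLoss X (X * (W₀ + Δ)) W₀ A' B) A =
      empCov X * (A * B - Δ) * Bᵀ := by
  ext i j
  have h1 : ∀ s : ℝ, X * (W₀ + (A + s • Matrix.single i j (1 : ℝ)) * B) - X * (W₀ + Δ)
      = X * (A * B - Δ) + s • (X * Matrix.single i j (1 : ℝ) * B) := fun s => by
    simp only [Matrix.mul_add, Matrix.add_mul, Matrix.mul_sub, Matrix.mul_smul, Matrix.smul_mul,
      Matrix.mul_assoc]
    abel
  rw [matGrad, Matrix.of_apply]
  simp only [loraLoss, h1]
  rw [deriv_frobNorm_sq, ← Matrix.mul_assoc, Matrix.trace_mul_comm, ← Matrix.mul_assoc,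
    ← Matrix.mul_assoc, trace_mul_single_one]
  simp only [empCov, Matrix.transpose_mul, Matrix.transpose_transpose, Matrix.smul_mul,
    Matrix.smul_apply, smul_eq_mul, Matrix.mul_assoc]
  ring

theorem matGrad_loraLoss_right (X : Matrix (Fin N) (Fin d) ℝ) (W₀ Δ : Matrix (Fin d) (Fin k) ℝ)
    (A : Matrix (Fin d) (Fin r) ℝ) (B : Matrix (Fin r) (Fin k) ℝ) :
    matGrad (fun B' => loraLoss X (X * (W₀ + Δ)) W₀ A B') B =
      Aᵀ * (empCov X * (A * B - Δ)) := by
  ext i j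
  have h1 : ∀ s : ℝ, X * (W₀ + A * (B + s • Matrix.single i j (1 : ℝ))) - X * (W₀ + Δ)
      = X * (A * B - Δ) + s • (X * A * Matrix.single i j (1 : ℝ)) := fun s => by
    simp only [Matrix.mul_add, Matrix.mul_sub, Matrix.mul_smul, Matrix.mul_assoc]
    abel
  rw [matGrad, Matrix.of_apply]
  simp only [loraLoss, h1]
  rw [deriv_frobNorm_sq, ← Matrix.mul_assoc, trace_mul_single_one]
  simp only [empCov, Matrix.transpose_mul, Matrix.transpose_transpose, Matrix.smul_mul,
    Matrix.mul_smul, Matrix.smul_apply, smul_eq_mul, Matrix.mul_assoc]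
  ring

end Gradients

/-! ### Bernstein's inequality for squares of sub-Gaussian variables -/

section Concentration

/-- The linear term is kept exact so that it vanishes in expectation for a centered variable. For
`|y| ≤ 1` this is Taylor's bound; beyond, the quadratic term dominates. -/
theorem exp_le_one_add_add_sq_mul (y : ℝ) :
    Real.exp y ≤ 1 + y + y ^ 2 * Real.exp |y| := by
  have h1 : 1 ≤ Real.exp |y| := Real.one_le_exp (abs_nonneg y)
  have h2 : y ^ 2 ≤ y ^ 2 * Real.exp |y| := le_mul_of_one_le_right (sq_nonneg y) h1
  rcases le_or_gt |y| 1 with hy | hy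
  · have := (abs_le.1 (Real.abs_exp_sub_one_sub_id_le hy)).2
    linarith
  · rcases lt_abs.1 hy with h | h
    · rw [abs_of_pos (by linarith)]
      have h3 : Real.exp y ≤ y ^ 2 * Real.exp y :=
        le_mul_of_one_le_left (Real.exp_pos y).le (by nlinarith)
      linarith
    · have : Real.exp y ≤ 1 := Real.exp_le_one_iff.2 (by linarith)
      nlinarith

/-- A pointwise bound for the exponential of a centered square. -/
theorem exp_mul_sq_sub_one_le {s θ : ℝ} (hs : 1 ≤ s) (hθ : |θ| ≤ 1 / (2 * s ^ 2)) (z : ℝ) :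
    Real.exp (θ * (z ^ 2 - 1)) ≤
      1 + θ * (z ^ 2 - 1) + 24 * s ^ 4 * θ ^ 2 * Real.exp (z ^ 2 / s ^ 2) := by
  set y := z ^ 2 - 1 with hy
  have hs0 : 0 < s := by linarith
  set u := |y| / (2 * s ^ 2) with hu
  have hu0 : 0 ≤ u := by positivity
  have h1 : |θ * y| ≤ u := by
    rw [abs_mul, hu, div_eq_mul_one_div, mul_comm]
    gcongr
  -- From `u² / 2 ≤ exp u`. This factor and `exp |θy| ≤ exp u` together use up only the available
  -- moment, because `2u ≤ z² / s² + 1`; the constant is `24 = 8 * 3` with `e ≤ 3`.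
  have h2 : y ^ 2 ≤ 8 * s ^ 4 * Real.exp u := by
    have h3 := Real.quadratic_le_exp_of_nonneg hu0
    have h4 : y ^ 2 = 8 * s ^ 4 * (u ^ 2 / 2) := by
      rw [hu, div_pow, sq_abs]
      field_simp
      ring
    rw [h4]
    gcongr
    linarith
  have h5 : u + u ≤ z ^ 2 / s ^ 2 + 1 := by
    have e : u + u = |y| / s ^ 2 := by rw [hu]; field_simp; ring
    rw [e, div_add' _ _ _ (by positivity)]
    gcongr
    rw [hy, abs_le]
    constructor <;> nlinarith [sq_nonneg z]
  have h6 : Real.exp u * Real.exp |θ * y| ≤ 3 * Real.exp (z ^ 2 / s ^ 2) := by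
    rw [← Real.exp_add]
    calc Real.exp (u + |θ * y|) ≤ Real.exp (z ^ 2 / s ^ 2 + 1) := Real.exp_le_exp.2 (by linarith)
      _ = Real.exp 1 * Real.exp (z ^ 2 / s ^ 2) := by rw [add_comm, Real.exp_add]
      _ ≤ 3 * Real.exp (z ^ 2 / s ^ 2) := by
          gcongr
          linarith [Real.exp_one_lt_d9]
  refine (exp_le_one_add_add_sq_mul (θ * y)).trans (add_le_add le_rfl ?_)
  calc (θ * y) ^ 2 * Real.exp |θ * y| = θ ^ 2 * y ^ 2 * Real.exp |θ * y| := by ring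
    _ ≤ θ ^ 2 * (8 * s ^ 4 * Real.exp u) * Real.exp |θ * y| := by gcongr
    _ = θ ^ 2 * (8 * s ^ 4) * (Real.exp u * Real.exp |θ * y|) := by ring
    _ ≤ θ ^ 2 * (8 * s ^ 4) * (3 * Real.exp (z ^ 2 / s ^ 2)) := by gcongr
    _ = _ := by ring

variable {Ω : Type*} [MeasurableSpace Ω] {μ : Measure Ω}

theorem integrable_exp_sq {Z : Ω → ℝ} (hZ : Measurable Z) {s : ℝ}
    (h : ∫⁻ ω, ENNReal.ofReal (Real.exp (Z ω ^ 2 / s ^ 2)) ∂μ ≤ 2) :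
    Integrable (fun ω => Real.exp (Z ω ^ 2 / s ^ 2)) μ := by
  refine (lintegral_ofReal_ne_top_iff_integrable (by fun_prop)
    (Filter.Eventually.of_forall fun ω => (Real.exp_pos _).le)).1 ?_
  exact (h.trans_lt (by simp)).ne

theorem integral_exp_sq_le {Z : Ω → ℝ} (hZ : Measurable Z) {s : ℝ}
    (h : ∫⁻ ω, ENNReal.ofReal (Real.exp (Z ω ^ 2 / s ^ 2)) ∂μ ≤ 2) :
    ∫ ω, Real.exp (Z ω ^ 2 / s ^ 2) ∂μ ≤ 2 := by
  rw [integral_eq_lintegral_of_nonneg_ae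
    (Filter.Eventually.of_forall fun ω => (Real.exp_pos _).le) (by fun_prop)]
  exact ENNReal.toReal_le_of_le_ofReal (by norm_num) (by simpa using h)

theorem integrable_sq_of_exp {Z : Ω → ℝ} (hZ : Measurable Z) {s : ℝ} (hs : 0 < s)
    (h : ∫⁻ ω, ENNReal.ofReal (Real.exp (Z ω ^ 2 / s ^ 2)) ∂μ ≤ 2) :
    Integrable (fun ω => Z ω ^ 2) μ := by
  refine ((integrable_exp_sq hZ h).const_mul (s ^ 2)).mono' (by fun_prop)
    (Filter.Eventually.of_forall fun ω => ?_)
  rw [Real.norm_of_nonneg (sq_nonneg _)]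
  have h1 := Real.add_one_le_exp (Z ω ^ 2 / s ^ 2)
  calc Z ω ^ 2 = s ^ 2 * (Z ω ^ 2 / s ^ 2) := by field_simp
    _ ≤ _ := by gcongr; linarith

/-- The square of a normalized sub-Gaussian random variable, centered, has a sub-exponential
moment generating function. -/
theorem mgf_sq_sub_one_le [IsProbabilityMeasure μ] {Z : Ω → ℝ} (hZ : Measurable Z) {s θ : ℝ}
    (hs : 1 ≤ s) (h : ∫⁻ ω, ENNReal.ofReal (Real.exp (Z ω ^ 2 / s ^ 2)) ∂μ ≤ 2)
    (hvar : ∫ ω, Z ω ^ 2 ∂μ = 1) (hθ : |θ| ≤ 1 / (2 * s ^ 2)) :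
    Integrable (fun ω => Real.exp (θ * (Z ω ^ 2 - 1))) μ ∧
      mgf (fun ω => Z ω ^ 2 - 1) μ θ ≤ Real.exp (48 * s ^ 4 * θ ^ 2) := by
  have hexp := integrable_exp_sq hZ h
  have hsq := integrable_sq_of_exp hZ (by linarith) h
  have hlin : Integrable (fun ω => 1 + θ * (Z ω ^ 2 - 1)) μ :=
    (integrable_const _).add ((hsq.sub (integrable_const _)).const_mul θ)
  have hb : Integrable (fun ω => 1 + θ * (Z ω ^ 2 - 1)
      + 24 * s ^ 4 * θ ^ 2 * Real.exp (Z ω ^ 2 / s ^ 2)) μ :=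
    hlin.add (hexp.const_mul _)
  have hint : Integrable (fun ω => Real.exp (θ * (Z ω ^ 2 - 1))) μ := by
    refine hb.mono' (by fun_prop) (Filter.Eventually.of_forall fun ω => ?_)
    rw [Real.norm_of_nonneg (Real.exp_pos _).le]
    exact exp_mul_sq_sub_one_le hs hθ _
  refine ⟨hint, ?_⟩
  have h1 : mgf (fun ω => Z ω ^ 2 - 1) μ θ ≤ ∫ ω, (1 + θ * (Z ω ^ 2 - 1)
      + 24 * s ^ 4 * θ ^ 2 * Real.exp (Z ω ^ 2 / s ^ 2)) ∂μ :=
    integral_mono hint hb fun ω => exp_mul_sq_sub_one_le hs hθ _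
  have h2 : ∫ ω, (1 + θ * (Z ω ^ 2 - 1)) ∂μ = 1 := by
    have h3 : Integrable (fun ω => θ * (Z ω ^ 2 - 1)) μ :=
      (hsq.sub (integrable_const _)).const_mul θ
    rw [integral_add (integrable_const _) h3, integral_const_mul,
      integral_sub hsq (integrable_const _), hvar]
    simp
  rw [integral_add hlin (hexp.const_mul _), h2, integral_const_mul] at h1
  have h3 := mul_le_mul_of_nonneg_left (integral_exp_sq_le hZ h)
    (by positivity : 0 ≤ 24 * s ^ 4 * θ ^ 2)
  have h4 := Real.add_one_le_exp (48 * s ^ 4 * θ ^ 2)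
  linarith

/-- Bernstein's inequality for the squares of independent normalized sub-Gaussian variables. -/
theorem measure_abs_sum_sq_sub_one_ge_le [IsProbabilityMeasure μ] {N : ℕ} {Z : Fin N → Ω → ℝ}
    (hZ : ∀ i, Measurable (Z i)) (hind : iIndepFun Z μ) {s τ : ℝ} (hs : 1 ≤ s)
    (h : ∀ i, ∫⁻ ω, ENNReal.ofReal (Real.exp (Z i ω ^ 2 / s ^ 2)) ∂μ ≤ 2)
    (hvar : ∀ i, ∫ ω, Z i ω ^ 2 ∂μ = 1) (hτ0 : 0 ≤ τ) (hτ1 : τ ≤ 1) :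
    μ.real {ω | N * τ ≤ |∑ i, (Z i ω ^ 2 - 1)|} ≤
      2 * Real.exp (-(τ ^ 2 * N / (192 * s ^ 4))) := by
  set Y : Fin N → Ω → ℝ := fun i ω => Z i ω ^ 2 - 1 with hY
  have hYm : ∀ i, Measurable (Y i) := fun i => by have := hZ i; fun_prop
  have hYind : iIndepFun Y μ := hind.comp (fun _ z => z ^ 2 - 1) (fun _ => by fun_prop)
  -- The minimizer of `-θτ + 48 s⁴ θ²`; `τ ≤ 1 ≤ s` keeps it in the range of the moment bound.
  set θ := τ / (96 * s ^ 4) with hθ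
  have hs0 : 0 < s := by linarith
  have hθ0 : 0 ≤ θ := by positivity
  have hθs : θ ≤ 1 / (2 * s ^ 2) := by
    rw [hθ, div_le_div_iff₀ (by positivity) (by positivity)]
    have : 1 ≤ s ^ 2 := by nlinarith
    nlinarith [sq_nonneg s]
  have key : ∀ t : ℝ, |t| = θ → Integrable (fun ω => Real.exp (t * (∑ i, Y i) ω)) μ ∧
      mgf (∑ i, Y i) μ t ≤ Real.exp (48 * s ^ 4 * θ ^ 2 * N) := fun t ht => by
    have h1 := fun i => mgf_sq_sub_one_le (hZ i) hs (h i) (hvar i) (ht.trans_le hθs)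
    refine ⟨hYind.integrable_exp_mul_sum hYm fun i _ => (h1 i).1, ?_⟩
    rw [hYind.mgf_sum hYm]
    have ht2 : t ^ 2 = θ ^ 2 := by rw [← ht, sq_abs]
    calc ∏ i, mgf (Y i) μ t ≤ ∏ _i : Fin N, Real.exp (48 * s ^ 4 * θ ^ 2) :=
          Finset.prod_le_prod (fun i _ => mgf_nonneg) fun i _ => ht2 ▸ (h1 i).2
      _ = Real.exp (48 * s ^ 4 * θ ^ 2 * N) := by
          rw [Finset.prod_const, ← Real.exp_nat_mul]
          simp [mul_comm]
  have hexp : -θ * (N * τ) + 48 * s ^ 4 * θ ^ 2 * N = -(τ ^ 2 * N / (192 * s ^ 4)) := by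
    rw [hθ]
    field_simp
    ring
  have hpos : μ.real {ω | N * τ ≤ (∑ i, Y i) ω} ≤ Real.exp (-(τ ^ 2 * N / (192 * s ^ 4))) := by
    have h1 := key θ (abs_of_nonneg hθ0)
    refine (measure_ge_le_exp_mul_mgf _ hθ0 h1.1).trans ?_
    rw [← hexp, Real.exp_add]
    gcongr
    exact h1.2
  have hneg : μ.real {ω | (∑ i, Y i) ω ≤ -(N * τ)} ≤
      Real.exp (-(τ ^ 2 * N / (192 * s ^ 4))) := by
    have h1 := key (-θ) (by rw [abs_neg, abs_of_nonneg hθ0])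
    refine (measure_le_le_exp_mul_mgf _ (by linarith) h1.1).trans ?_
    rw [← hexp, Real.exp_add]
    have e : - -θ * -(N * τ) = -θ * (N * τ) := by ring
    rw [e]
    gcongr
    exact h1.2
  have hsub : {ω | N * τ ≤ |∑ i, (Z i ω ^ 2 - 1)|} ⊆
      {ω | N * τ ≤ (∑ i, Y i) ω} ∪ {ω | (∑ i, Y i) ω ≤ -(N * τ)} := fun ω hω => by
    simp only [Set.mem_ofPred_eq, Set.mem_union, Finset.sum_apply, hY] at hω ⊢
    rcases le_abs.1 hω with h1 | h1
    · exact Or.inl h1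
    · exact Or.inr (by linarith)
  refine (measureReal_mono hsub).trans ((measureReal_union_le _ _).trans ?_)
  linarith

/-- A bound on the sub-Gaussian norm gives a bound on the exponential moment. -/
theorem lintegral_exp_le_of_psi2Norm_le {Z : Ω → ℝ} {K : ℝ≥0} (h : psi2Norm μ Z ≤ K) :
    ∫⁻ ω, ENNReal.ofReal (Real.exp (Z ω ^ 2 / ((K : ℝ) + 1) ^ 2)) ∂μ ≤ 2 := by
  -- The slack `+ 1` yields an admissible `s` without attainment of the infimum; it also makes the
  -- scale at least `1`, as Bernstein's inequality requires.
  have h1 : psi2Norm μ Z < ENNReal.ofReal ((K : ℝ) + 1) := by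
    refine h.trans_lt ?_
    have h2 : ENNReal.ofReal ((K : ℝ) + 1) = ((K + 1 : ℝ≥0) : ℝ≥0∞) := by
      rw [← ENNReal.ofReal_coe_nnreal, NNReal.coe_add, NNReal.coe_one]
    rw [h2]
    exact_mod_cast lt_add_one K
  simp only [psi2Norm, iInf_lt_iff] at h1
  obtain ⟨s, ⟨hs, hle⟩, hlt⟩ := h1
  have hsK : s < K + 1 := (ENNReal.ofReal_lt_ofReal_iff (by positivity)).1 hlt
  refine (lintegral_mono fun ω => ?_).trans hle
  refine ENNReal.ofReal_le_ofReal (Real.exp_le_exp.2 ?_)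
  gcongr

/-! ### Nets of the sphere and the norm of a symmetric operator -/

/-- A `1/2`-separated set of maximal cardinality is a net, since a point far from it could be added.
Separation bounds the cardinality by a volume argument. -/
theorem exists_sphere_net (d : ℕ) : ∃ t : Finset (EuclideanSpace ℝ (Fin d)),
    t.card ≤ 5 ^ d ∧ (∀ y ∈ t, ‖y‖ = 1) ∧
      ∀ x : EuclideanSpace ℝ (Fin d), ‖x‖ = 1 → ∃ y ∈ t, ‖x - y‖ ≤ 1 / 2 := by
  classical
  let good : Finset (EuclideanSpace ℝ (Fin d)) → Prop := fun t =>
    (∀ y ∈ t, ‖y‖ = 1) ∧ ∀ y ∈ t, ∀ z ∈ t, y ≠ z → 1 / 2 ≤ ‖y - z‖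
  have hcard : ∀ t, good t → t.card ≤ 5 ^ d := fun t ht => by
    have hinj : Function.Injective fun y : EuclideanSpace ℝ (Fin d) => (2 : ℝ) • y :=
      smul_right_injective _ two_ne_zero
    -- Doubling gives `1`-separated points in the ball of radius `2`, the normalization of this
    -- bound.
    have h1 := Besicovitch.card_le_of_separated (t.image fun y => (2 : ℝ) • y)
      (fun c hc => by
        obtain ⟨y, hy, rfl⟩ := Finset.mem_image.1 hc
        rw [norm_smul, ht.1 y hy]
        norm_num)
      (fun c hc e he hne => by
        obtain ⟨y, hy, rfl⟩ := Finset.mem_image.1 hc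
        obtain ⟨z, hz, rfl⟩ := Finset.mem_image.1 he
        rw [← smul_sub, norm_smul]
        have := ht.2 y hy z hz (fun hyz => hne (by rw [hyz]))
        norm_num
        linarith)
    rwa [Finset.card_image_of_injective _ hinj, finrank_euclideanSpace_fin] at h1
  let p : ℕ → Prop := fun n => ∃ t, good t ∧ t.card = n
  have hp0 : p 0 := ⟨∅, ⟨by simp, by simp⟩, rfl⟩
  obtain ⟨t, ht, htc⟩ : p (Nat.findGreatest p (5 ^ d)) :=
    Nat.findGreatest_spec (Nat.zero_le _) hp0
  refine ⟨t, hcard t ht, ht.1, fun x hx => ?_⟩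
  by_contra! hfar
  have hxt : x ∉ t := fun hmem => by
    have := hfar x hmem
    simp at this
    linarith
  have hgood : good (insert x t) := by
    refine ⟨fun y hy => ?_, fun y hy z hz hyz => ?_⟩
    · rcases Finset.mem_insert.1 hy with rfl | hy
      exacts [hx, ht.1 y hy]
    · rcases Finset.mem_insert.1 hy with hy | hy <;> rcases Finset.mem_insert.1 hz with hz | hz
      · exact absurd (hy.trans hz.symm) hyz
      · exact hy ▸ (hfar z hz).le
      · rw [norm_sub_rev]
        exact hz ▸ (hfar y hy).le
      · exact ht.2 y hy z hz hyz
  have hc : (insert x t).card = Nat.findGreatest p (5 ^ d) + 1 := by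
    rw [Finset.card_insert_of_notMem hxt, htc]
  have hp : p (insert x t).card := ⟨_, hgood, rfl⟩
  have hle := Nat.le_findGreatest (hcard _ hgood) hp
  omega

/-- With `a = ‖x - y‖² ≤ 1/4` the parallelogram law gives `a(4 - a) ≤ 15/16 ≤ (31/32)²`. A constant
below `1` is what the net argument needs. -/
theorem norm_sub_mul_norm_add_le {E : Type*} [NormedAddCommGroup E] [InnerProductSpace ℝ E]
    {x y : E} (hx : ‖x‖ = 1) (hy : ‖y‖ = 1) (hxy : ‖x - y‖ ≤ 1 / 2) :
    ‖x - y‖ * ‖x + y‖ ≤ 31 / 32 := by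
  have h1 := parallelogram_law_with_norm ℝ x y
  rw [hx, hy] at h1
  have h2 : ‖x - y‖ ^ 2 ≤ 1 / 4 := by nlinarith [norm_nonneg (x - y)]
  refine le_of_sq_le_sq ?_ (by norm_num)
  have h3 : ‖x + y‖ ^ 2 = 4 - ‖x - y‖ ^ 2 := by nlinarith
  rw [mul_pow, h3]
  nlinarith [sq_nonneg (‖x - y‖)]

/-- The norm of a symmetric operator is controlled by its quadratic form on a net of the unit
sphere. -/
theorem norm_le_of_net {E : Type*} [NormedAddCommGroup E] [InnerProductSpace ℝ E]
    {T : E →L[ℝ] E} (hT : (T : E →ₗ[ℝ] E).IsSymmetric) {t : Set E}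
    (ht : ∀ y ∈ t, ‖y‖ = 1) (hnet : ∀ x : E, ‖x‖ = 1 → ∃ y ∈ t, ‖x - y‖ ≤ 1 / 2) {τ : ℝ}
    (hτ0 : 0 ≤ τ) (hτ : ∀ y ∈ t, |inner ℝ (T y) y| ≤ τ) : ‖T‖ ≤ 32 * τ := by
  have hunit : ∀ x : E, ‖x‖ = 1 → |inner ℝ (T x) x| ≤ τ + 31 / 32 * ‖T‖ := fun x hx => by
    obtain ⟨y, hy, hxy⟩ := hnet x hx
    -- Symmetry makes the difference of the quadratic forms a product of `x - y` and `x + y`. The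
    -- resulting `‖T‖ ≤ τ + (31/32)‖T‖` is solved for `‖T‖`, whence the factor `32`.
    have h1 : inner ℝ (T x) x = inner ℝ (T y) y + inner ℝ (T (x - y)) (x + y) := by
      have h2 : inner ℝ (T x) y = inner ℝ (T y) x := by
        rw [real_inner_comm x (T y)]
        exact hT x y
      simp only [map_sub, inner_sub_left, inner_add_right]
      linarith
    have h3 : |inner ℝ (T (x - y)) (x + y)| ≤ 31 / 32 * ‖T‖ := by
      calc |inner ℝ (T (x - y)) (x + y)| ≤ ‖T (x - y)‖ * ‖x + y‖ := abs_real_inner_le_norm _ _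
        _ ≤ ‖T‖ * ‖x - y‖ * ‖x + y‖ := by gcongr; exact T.le_opNorm _
        _ = ‖x - y‖ * ‖x + y‖ * ‖T‖ := by ring
        _ ≤ 31 / 32 * ‖T‖ := by
          gcongr
          exact norm_sub_mul_norm_add_le hx (ht y hy) hxy
    rw [h1]
    exact (abs_add_le _ _).trans (add_le_add (hτ y hy) h3)
  have hle : ‖T‖ ≤ τ + 31 / 32 * ‖T‖ := by
    conv_lhs => rw [ContinuousLinearMap.norm_eq_iSup_rayleighQuotient T hT]
    refine ciSup_le fun x => ?_
    by_cases hx : x = 0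
    · simp only [hx, ContinuousLinearMap.rayleighQuotient_apply_zero, abs_zero]
      positivity
    · have hx' : ‖x‖ ≠ 0 := norm_ne_zero_iff.2 hx
      have h1 := ContinuousLinearMap.rayleigh_smul T x (inv_ne_zero hx' : (‖x‖⁻¹ : ℝ) ≠ 0)
      have h2 : ‖(‖x‖⁻¹ : ℝ) • x‖ = 1 := by
        rw [norm_smul, norm_inv, norm_norm, inv_mul_cancel₀ hx']
      rw [← h1, ContinuousLinearMap.rayleighQuotient, h2,
        ContinuousLinearMap.reApplyInnerSelf_apply]
      simpa using hunit _ h2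
  linarith

/-! ### Concentration of the empirical covariance -/

variable {N d : ℕ}

theorem lintegral_exp_inner_le {x : Ω → EuclideanSpace ℝ (Fin d)} {K : ℝ≥0}
    (h : IsIsotropicSubGaussian μ x K) {v : EuclideanSpace ℝ (Fin d)} (hv : ‖v‖ = 1) :
    ∫⁻ ω, ENNReal.ofReal (Real.exp (inner ℝ v (x ω) ^ 2 / ((K : ℝ) + 1) ^ 2)) ∂μ ≤ 2 :=
  lintegral_exp_le_of_psi2Norm_le ((le_iSup₂ (f := fun (v : EuclideanSpace ℝ (Fin d))
    (_ : ‖v‖ = 1) => psi2Norm μ fun ω => inner ℝ v (x ω)) v hv).trans h.subGaussian)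

theorem IsIsotropicSubGaussian.integrable_mul {x : Ω → EuclideanSpace ℝ (Fin d)} {K : ℝ≥0}
    (h : IsIsotropicSubGaussian μ x K) (a b : Fin d) :
    Integrable (fun ω => x ω a * x ω b) μ := by
  have hm := h.measurable
  have hsq : ∀ a, Integrable (fun ω => x ω a ^ 2) μ := fun a => by
    have h1 := integrable_sq_of_exp (Z := fun ω => inner ℝ (EuclideanSpace.single a (1 : ℝ)) (x ω))
      (by fun_prop) (by positivity) (lintegral_exp_inner_le h (by simp))
    simpa [EuclideanSpace.inner_single_left] using h1
  refine ((hsq a).add (hsq b)).mono' (by fun_prop) (Filter.Eventually.of_forall fun ω => ?_)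
  rw [Real.norm_eq_abs, Pi.add_apply, abs_le]
  constructor <;> nlinarith [sq_nonneg (x ω a + x ω b), sq_nonneg (x ω a - x ω b)]

theorem IsIsotropicSubGaussian.integral_inner_sq {x : Ω → EuclideanSpace ℝ (Fin d)} {K : ℝ≥0}
    (h : IsIsotropicSubGaussian μ x K) {v : EuclideanSpace ℝ (Fin d)} (hv : ‖v‖ = 1) :
    ∫ ω, inner ℝ v (x ω) ^ 2 ∂μ = 1 := by
  have h1 : ∀ ω, inner ℝ v (x ω) ^ 2 = ∑ a, ∑ b, v a * v b * (x ω a * x ω b) := fun ω => by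
    rw [PiLp.inner_apply, sq, Finset.sum_mul_sum]
    refine Finset.sum_congr rfl fun a _ => Finset.sum_congr rfl fun b _ => ?_
    simp
    ring
  simp_rw [h1]
  have hint : ∀ a b, Integrable (fun ω => v a * v b * (x ω a * x ω b)) μ := fun a b =>
    (h.integrable_mul a b).const_mul _
  rw [integral_finsetSum _ fun a _ => integrable_finsetSum _ fun b _ => hint a b]
  have h2 : ∀ a, ∫ ω, ∑ b, v a * v b * (x ω a * x ω b) ∂μ = v a ^ 2 := fun a => by
    rw [integral_finsetSum _ fun b _ => hint a b]
    simp_rw [integral_const_mul, h.isotropic]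
    simp [sq]
  simp_rw [h2]
  rw [← EuclideanSpace.real_norm_sq_eq, hv, one_pow]

theorem inner_empCov_sub_one (X : Matrix (Fin N) (Fin d) ℝ) (v : EuclideanSpace ℝ (Fin d)) :
    inner ℝ (Matrix.toEuclideanCLM (n := Fin d) (𝕜 := ℝ) (empCov X - 1) v) v =
      1 / N * (∑ i, (∑ j, X i j * v j) ^ 2) - ‖v‖ ^ 2 := by
  have h1 : Matrix.toEuclideanCLM (n := Fin d) (𝕜 := ℝ) (empCov X - 1) v
      = (1 / (N : ℝ)) • act (Xᵀ * X) v - v := by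
    rw [← act_smul]
    conv_rhs => rw [← act_one v, ← act_mul, Matrix.mul_one, ← act_sub]
    rfl
  rw [h1, inner_sub_left, real_inner_self_eq_norm_sq, inner_smul_left, real_inner_comm,
    ← norm_act_sq, EuclideanSpace.real_norm_sq_eq]
  rfl

theorem isSymmetric_empCov_sub_one (X : Matrix (Fin N) (Fin d) ℝ) :
    ((Matrix.toEuclideanCLM (n := Fin d) (𝕜 := ℝ) (empCov X - 1) :
      EuclideanSpace ℝ (Fin d) →L[ℝ] EuclideanSpace ℝ (Fin d)) :
      EuclideanSpace ℝ (Fin d) →ₗ[ℝ] EuclideanSpace ℝ (Fin d)).IsSymmetric := fun v w => by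
  have h1 := inner_act (empCov X - 1) v w
  have h2 : (empCov X - 1)ᵀ = empCov X - 1 := by
    simp [empCov, Matrix.transpose_mul]
  rw [h2] at h1
  exact h1

theorem measurable_opNorm_empCov {x : Fin N → Ω → EuclideanSpace ℝ (Fin d)}
    (hx : ∀ i, Measurable (x i)) :
    Measurable fun ω => opNorm (empCov (dataMatrix x ω) - 1) := by
  have hcont : Continuous fun X : Fin N → EuclideanSpace ℝ (Fin d) =>
      opNorm (empCov (Matrix.of fun i j => X i j) - 1) := by
    unfold opNorm
    refine continuous_norm.comp ?_
    have h1 : Continuous fun M : Matrix (Fin d) (Fin d) ℝ =>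
        Matrix.toEuclideanCLM (n := Fin d) (𝕜 := ℝ) M :=
      LinearMap.continuous_of_finiteDimensional
        ((Matrix.toEuclideanLin (𝕜 := ℝ) (m := Fin d) (n := Fin d)).trans
          LinearMap.toContinuousLinearMap).toLinearMap
    refine h1.comp ?_
    unfold empCov
    have h2 : Continuous fun X : Fin N → EuclideanSpace ℝ (Fin d) =>
        (Matrix.of fun i j => X i j : Matrix (Fin N) (Fin d) ℝ) :=
      continuous_matrix fun i j => by fun_prop
    exact ((h2.matrix_transpose.matrix_mul h2).const_smul (1 / (N : ℝ))).sub continuous_const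
  exact hcont.measurable.comp (measurable_pi_iff.2 hx)

/-- Concentration of the empirical covariance matrix of isotropic sub-Gaussian vectors. -/
theorem measure_opNorm_empCov_sub_one_le [IsProbabilityMeasure μ] {K : ℝ≥0}
    {x : Fin N → Ω → EuclideanSpace ℝ (Fin d)} (hx : ∀ i, IsIsotropicSubGaussian μ (x i) K)
    (hind : iIndepFun x μ) (hN : 0 < N) {ε : ℝ} (hε0 : 0 ≤ ε) (hε1 : ε ≤ 1) :
    1 - 2 * 5 ^ d * Real.exp (-(1 / (192 * 1024 * ((K : ℝ) + 1) ^ 4) * ε ^ 2 * N)) ≤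
      μ.real {ω | opNorm (empCov (dataMatrix x ω) - 1) ≤ ε} := by
  obtain ⟨t, htc, ht1, htnet⟩ := exists_sphere_net d
  set s : ℝ := (K : ℝ) + 1 with hs
  have hN' : (0 : ℝ) < N := by exact_mod_cast hN
  have hmeas : MeasurableSet {ω | opNorm (empCov (dataMatrix x ω) - 1) ≤ ε} :=
    measurableSet_le (measurable_opNorm_empCov fun i => (hx i).measurable) measurable_const
  -- Bad event in direction `v`. The threshold `ε / 32` offsets the loss in the net argument and
  -- puts `1024 = 32²` into the exponent.
  set F : EuclideanSpace ℝ (Fin d) → Set Ω := fun v =>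
    {ω | N * (ε / 32) ≤ |∑ i, (inner ℝ v (x i ω) ^ 2 - 1)|} with hF
  have hFv : ∀ v ∈ t, μ.real (F v) ≤
      2 * Real.exp (-(1 / (192 * 1024 * s ^ 4) * ε ^ 2 * N)) := fun v hv => by
    have h1 := measure_abs_sum_sq_sub_one_ge_le (Z := fun i ω => inner ℝ v (x i ω)) (s := s)
      (τ := ε / 32) (μ := μ) (fun i => by have := (hx i).measurable; fun_prop)
      (hind.comp (fun _ y => inner ℝ v y) (fun _ => by fun_prop))
      (by rw [hs]; linarith [K.2]) (fun i => lintegral_exp_inner_le (hx i) (ht1 v hv))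
      (fun i => (hx i).integral_inner_sq (ht1 v hv)) (by linarith) (by linarith)
    have h2 : (ε / 32) ^ 2 * N / (192 * s ^ 4) = 1 / (192 * 1024 * s ^ 4) * ε ^ 2 * N := by
      ring_nf
    rwa [h2] at h1
  have hsub : {ω | opNorm (empCov (dataMatrix x ω) - 1) ≤ ε}ᶜ ⊆ ⋃ v ∈ t, F v := fun ω hω => by
    by_contra hnot
    simp only [Set.mem_iUnion, not_exists] at hnot
    refine hω (?_ : opNorm _ ≤ ε)
    have h1 := norm_le_of_net (t := (t : Set (EuclideanSpace ℝ (Fin d)))) (τ := ε / 32)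
      (isSymmetric_empCov_sub_one (dataMatrix x ω)) ht1 htnet (by linarith) fun v hv => by
        have h2 : |∑ i, (inner ℝ v (x i ω) ^ 2 - 1)| < N * (ε / 32) := not_le.1 (hnot v hv)
        have h3 : 1 / (N : ℝ) * (∑ i, (∑ j, dataMatrix x ω i j * v j) ^ 2) - ‖v‖ ^ 2
            = 1 / (N : ℝ) * ∑ i, (inner ℝ v (x i ω) ^ 2 - 1) := by
          rw [ht1 v hv, Finset.sum_sub_distrib, mul_sub]
          simp [dataMatrix, PiLp.inner_apply, hN'.ne']
        rw [inner_empCov_sub_one, h3, abs_mul, abs_of_pos (by positivity)]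
        calc 1 / (N : ℝ) * |∑ i, (inner ℝ v (x i ω) ^ 2 - 1)|
            ≤ 1 / (N : ℝ) * (N * (ε / 32)) := by gcongr
          _ = ε / 32 := by field_simp
    have h4 : 32 * (ε / 32) = ε := by ring
    rw [h4] at h1
    exact h1
  have h5 : μ.real {ω | opNorm (empCov (dataMatrix x ω) - 1) ≤ ε}ᶜ ≤
      2 * 5 ^ d * Real.exp (-(1 / (192 * 1024 * s ^ 4) * ε ^ 2 * N)) := by
    calc μ.real {ω | opNorm (empCov (dataMatrix x ω) - 1) ≤ ε}ᶜ ≤ μ.real (⋃ v ∈ t, F v) :=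
          measureReal_mono hsub (measure_ne_top _ _)
      _ ≤ ∑ v ∈ t, μ.real (F v) := measureReal_biUnion_finset_le _ _
      _ ≤ ∑ _v ∈ t, 2 * Real.exp (-(1 / (192 * 1024 * s ^ 4) * ε ^ 2 * N)) :=
          Finset.sum_le_sum hFv
      _ = t.card * (2 * Real.exp (-(1 / (192 * 1024 * s ^ 4) * ε ^ 2 * N))) := by simp
      _ ≤ ((5 ^ d : ℕ) : ℝ) * (2 * Real.exp (-(1 / (192 * 1024 * s ^ 4) * ε ^ 2 * N))) := by
          gcongr
      _ = _ := by push_cast; ring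
  rw [probReal_compl_eq_one_sub hmeas] at h5
  linarith

end Concentration

/-! ### Assembly of the two parts -/

section Main

open scoped Matrix.Norms.L2Operator

variable {N d k r : ℕ}

theorem stepConditions_of_le {L l κ ε η : ℝ} (hl : 0 < l) (hlL : l ≤ L) (hκ : κ = L / l)
    (hε : 0 < ε) (hε' : ε ≤ l / (32 * κ * (32 * L + 128 * κ ^ 2))) (hη : 0 < η)
    (hη₁ : η ≤ 1 / (128 * κ * L)) (hη₂ : η ≤ (1 - ε / κ) / (1152 * L)) :
    StepConditions L l κ ε η := by
  have hL : 0 < L := hl.trans_le hlL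
  have hκ1 : 1 ≤ κ := by rw [hκ]; exact (one_le_div hl).2 hlL
  have hLκ : L = κ * l := by rw [hκ]; field_simp
  have hκ0 : 0 < κ := by linarith
  refine ⟨hl, hκ1, hLκ, hε, ?_, hη, ?_, ?_⟩
  · rw [le_div_iff₀ (by positivity)] at hε'
    -- Only the summand `32 * L` of the denominator is kept; `L = κ * l` then gives `1024 κ² ε ≤ 1`.
    have h1 : 1024 * κ ^ 2 * ε * l ≤ 1 * l := by
      calc 1024 * κ ^ 2 * ε * l = ε * (32 * κ * (32 * L)) := by rw [hLκ]; ring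
        _ ≤ ε * (32 * κ * (32 * L + 128 * κ ^ 2)) := by
          gcongr
          linarith [pow_pos hκ0 2]
        _ ≤ 1 * l := by linarith
    exact le_of_mul_le_mul_right h1 hl
  · rw [le_div_iff₀ (by positivity)] at hη₁
    linarith
  · rw [le_div_iff₀ (by positivity)] at hη₂
    have : 0 < ε / κ := by positivity
    linarith

/-- Linear convergence of gradient descent from a spectral initialization when the empirical
covariance is near the identity. -/
theorem frobNorm_gdIter_sub_le {X : Matrix (Fin N) (Fin d) ℝ} {W₀ Δ : Matrix (Fin d) (Fin k) ℝ}
    {κ ε η : ℝ} (h : StepConditions (sval Δ 1) (sval Δ Δ.rank) κ ε η) {hrd : r ≤ d} {hrk : r ≤ k}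
    (hr : Δ.rank ≤ r) (hX : opNorm (empCov X - 1) ≤ ε) {A₀ : Matrix (Fin d) (Fin r) ℝ}
    {B₀ : Matrix (Fin r) (Fin k) ℝ}
    (hinit : IsSpectralInit hrd hrk (oneStepGrad X (X * (W₀ + Δ)) W₀) A₀ B₀) (t : ℕ) :
    frobNorm ((gdIter X (X * (W₀ + Δ)) W₀ η A₀ B₀ t).1 *
        (gdIter X (X * (W₀ + Δ)) W₀ η A₀ B₀ t).2 - Δ) ≤
      √Δ.rank * ((1 - η * sval Δ Δ.rank / 4) ^ t * (ε * sval Δ 1)) := by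
  rw [opNorm_eq_norm] at hX
  rw [oneStepGrad_eq] at hinit
  obtain ⟨U, S, V, hS, hA, hB⟩ := hinit.exists_diagonal
  have hε1 : ε < 1 := by linarith [h.ε_le_inv]
  have hrank : (empCov X * Δ).rank ≤ Δ.rank := Matrix.rank_mul_le_right _ _
  have hG : ‖empCov X * Δ‖ ≤ (1 + ε) * sval Δ 1 :=
    norm_mul_le' (norm_le_one_add hX) (norm_le_sval_one Δ)
  have hΔP := hS.mul_rowProj_of_mul hX hε1
  have hE0 : ‖A₀ * B₀ - Δ‖ ≤ ε * sval Δ 1 := by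
    have h1 : A₀ * B₀ - Δ = (empCov X - 1) * Δ := by
      rw [hS.init_mul (hrank.trans hr) hA hB, Matrix.sub_mul, Matrix.one_mul]
    rw [h1]
    exact norm_mul_le' hX (norm_le_sval_one Δ)
  obtain ⟨hBP, hEt, -, -⟩ := gd_converges h (Sig := empCov X) (Δ := Δ)
    (A := fun t => (gdIter X (X * (W₀ + Δ)) W₀ η A₀ B₀ t).1)
    (B := fun t => (gdIter X (X * (W₀ + Δ)) W₀ η A₀ B₀ t).2)
    (rowProj_transpose S V) hΔP hX
    (fun t => by rw [← matGrad_loraLoss_left X W₀ Δ]; rfl)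
    (fun t => by rw [← matGrad_loraLoss_right X W₀ Δ]; rfl)
    (hS.init_right_mul_rowProj hB) ((hS.norm_init_left_sq_le hA).trans hG)
    ((hS.norm_init_right_sq_le hB).trans hG)
    (hS.init_right_coercive (hrank.trans hr) hB (hS.le_diagEntry hX hε1)) hE0 t
  refine (hS.frobNorm_le ?_).trans ?_
  · rw [Matrix.sub_mul, hΔP, Matrix.mul_assoc, hBP]
  · gcongr

/-- The estimate proved is stronger in each factor: `√n ≤ √(2n)`, the rate `l / 4` beats `l /
(64κ)`, and `εL ≤ l`. -/
theorem StepConditions.bound_le {L l κ ε η : ℝ} (h : StepConditions L l κ ε η) (n t : ℕ) :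
    √n * ((1 - η * l / 4) ^ t * (ε * L)) ≤ √(2 * n) * (1 - η * (l / (64 * κ))) ^ t * l := by
  have hl := h.l_pos
  have hη := h.η_pos
  have hκ := h.one_le
  have h1 : l / (64 * κ) ≤ l / 4 := by
    gcongr
    linarith
  have h2 : 1 - η * l / 4 ≤ 1 - η * (l / (64 * κ)) := by
    have := mul_le_mul_of_nonneg_left h1 hη.le
    linarith
  have h3 : ε * L ≤ l := by linarith [h.εL_le, mul_pos h.ε_pos h.L_pos]
  have h4 : (n : ℝ) ≤ 2 * n := by linarith [(n.cast_nonneg : (0 : ℝ) ≤ n)]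
  have h5 := h.rate_nonneg
  have h6 := mul_pos h.ε_pos h.L_pos
  rw [mul_assoc]
  have h7 : 0 ≤ 1 - η * (l / (64 * κ)) := h5.trans h2
  gcongr

end Main

end LoRA

theorem mainTheorem3 (K : ℝ≥0) :
    ∃ C c : ℝ, 0 < C ∧ 0 < c ∧
      ∀ {Ω : Type*} [MeasurableSpace Ω] (μ : Measure Ω) [IsProbabilityMeasure μ]
        (N d k r : ℕ) (hrd : r ≤ d) (hrk : r ≤ k)
        (W₀ Δ : Matrix (Fin d) (Fin k) ℝ) (rs : ℕ) (lam₁ lamr κ ε η : ℝ)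
        (x : Fin N → Ω → EuclideanSpace ℝ (Fin d)),
        d < N →
        Δ.rank = rs → 0 < rs → rs < min d k → rs ≤ r →
        lam₁ = LoRA.sval Δ 1 → lamr = LoRA.sval Δ rs → κ = LoRA.condNumber Δ →
        (∀ i, LoRA.IsIsotropicSubGaussian μ (x i) K) →
        iIndepFun x μ → (∀ i j, IdentDistrib (x i) (x j) μ μ) →
        0 < ε → ε ≤ min (1 / (2 * κ)) (lamr / (32 * κ * (32 * lam₁ + 128 * κ ^ 2))) →
        0 < η → η ≤ min (1 / (128 * κ * lam₁)) ((1 - ε / κ) / (1152 * lam₁)) →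
        ∃ E : Set Ω, MeasurableSet E ∧
          1 - 2 * C ^ d * Real.exp (-(c * ε ^ 2 * N)) ≤ μ.real E ∧
          ∀ ω ∈ E,
            LoRA.opNorm (LoRA.empCov (LoRA.dataMatrix x ω) - 1) ≤ ε ∧
            ∀ (A₀ : Matrix (Fin d) (Fin r) ℝ) (B₀ : Matrix (Fin r) (Fin k) ℝ),
              LoRA.IsSpectralInit hrd hrk
                (LoRA.oneStepGrad (LoRA.dataMatrix x ω) (LoRA.dataMatrix x ω * (W₀ + Δ)) W₀)
                A₀ B₀ →
              ∀ t : ℕ,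
                LoRA.frobNorm
                  ((LoRA.gdIter (LoRA.dataMatrix x ω) (LoRA.dataMatrix x ω * (W₀ + Δ)) W₀ η
                      A₀ B₀ t).1 *
                    (LoRA.gdIter (LoRA.dataMatrix x ω) (LoRA.dataMatrix x ω * (W₀ + Δ)) W₀ η
                      A₀ B₀ t).2 - Δ) ≤
                  Real.sqrt (2 * rs) * (1 - η * (lamr / (64 * κ))) ^ t * lamr := by
  -- `5` is the base of the net's cardinality; `c` combines Bernstein's `192 s⁴` at `s = K + 1` with
  -- the net's `32²`.
  refine ⟨5, 1 / (192 * 1024 * ((K : ℝ) + 1) ^ 4), by norm_num, by positivity, ?_⟩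
  intro Ω _ μ _ N d k r hrd hrk W₀ Δ rs lam₁ lamr κ ε η x hdN hrank hrs _ hrsr hlam₁ hlamr hκ
    hx hind _ hε hε' hη hη'
  subst hrank hlam₁ hlamr
  have hcond := LoRA.stepConditions_of_le (LoRA.sval_rank_pos Δ hrs)
    (LoRA.sval_rank_le_sval_one Δ) hκ hε (hε'.trans (min_le_right _ _)) hη
    (hη'.trans (min_le_left _ _)) (hη'.trans (min_le_right _ _))
  -- The event is covariance accuracy alone; on it everything is deterministic, so all spectral
  -- initializations and all times are covered without a further union bound.
  refine ⟨{ω | LoRA.opNorm (LoRA.empCov (LoRA.dataMatrix x ω) - 1) ≤ ε},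
    measurableSet_le (LoRA.measurable_opNorm_empCov fun i => (hx i).measurable) measurable_const,
    LoRA.measure_opNorm_empCov_sub_one_le hx hind (by omega) hε.le
      (by linarith [hcond.ε_le_inv]), fun ω hω => ⟨hω, fun A₀ B₀ hinit t => ?_⟩⟩
  exact (LoRA.frobNorm_gdIter_sub_le hcond hrsr hω hinit t).trans (hcond.bound_le _ t)
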